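/- Let $M$ be a smooth (Hausdorff) manifold of dimension $n$ and let $\nabla$ be a smooth torsion-free affine connection on $M$, with curvature $R(X,Y)Z=\nabla_X\nabla_YZ-\nabla_Y\nabla_XZ-\nabla_{[X,Y]}Z$. For $p\in M$ and $v\in T_pM$ let $S^\nabla(v):T_pM\to T_pM$, $S^\nabla(v)w=(\nabla_vR)(w,v)v$, be the affine Szabó operator. $(M,\nabla)$ is called affine Szabó if, for each $p\in M$, the operators $S^\nabla(v)$, $v\in T_pM$, all have the same characteristic polynomial. A pseudo-Riemannian manifold $(N,g)$ is called Szabó if the eigenvalues, counted with multiplicity (that is, the characteristic polynomial), of the Szabó operators $S(v)$ of its Levi-Civita connection are constant on the unit pseudo-sphere bundle $\{v\in TN: g(v,v)=1\}$ and constant on $\{v\in TN: g(v,v)=-1\}$. **Theorem.** There is exactly one smooth pseudo-Riemannian metric $g_\nabla$ on the cotangent bundle $T^*M$ (the Riemannian extension of $\nabla$) whose matrix, in the coordinates $(u_1,\dots,u_n,u_{1'},\dots,u_{n'})$ induced on $T^*M$ by any chart $(u_1,\dots,u_n)$ of $M$, is $$\begin{pmatrix}-2\sum_k u_{k'}\Gamma^k_{ij}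 & \delta_i^j\\ \delta_i^j & 0\end{pmatrix},$$ where $\nabla_{\partial_i}\partial_j=\sum_k\Gamma^k_{ij}\partial_k$. It has neutral signature $(n,n)$. Moreover, $(M,\nabla)$ is affine Szabó if and only if $(T^*M,g_\nabla)$ is a pseudo-Riemannian Szabó manifold. -/

import Mathlib

open Bundle
open scoped Manifold ContDiff

noncomputable section

namespace SzaboGeometry

/-! ### Curvature and the Szabó operator of an affine connection

`D` below is a connection on the tangent bundle of a manifold `N`; in Mathlib's convention
`D Y x (X x)` is the value at `x` of `∇_X Y`. -/

section Connection

variable {F : Type*} [NormedAddCommGroup F] [NormedSpace ℝ F]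
  {H : Type*} [TopologicalSpace H] {J : ModelWithCorners ℝ F H}
  {N : Type*} [TopologicalSpace N] [ChartedSpace H N] [IsManifold J ∞ N]

/-- The vector field `∇_X Y`. -/
def nabla (D : CovariantDerivative J F (TangentSpace J : N → Type _))
    (X Y : Π x : N, TangentSpace J x) : Π x : N, TangentSpace J x :=
  fun x => D Y x (X x)

/-- The curvature `R(X, Y)Z = ∇_X ∇_Y Z - ∇_Y ∇_X Z - ∇_[X,Y] Z`. -/
def curvature (D : CovariantDerivative J F (TangentSpace J : N → Type _))
    (X Y Z : Π x : N, TangentSpace J x) : Π x : N, TangentSpace J x :=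
  nabla D X (nabla D Y Z) - nabla D Y (nabla D X Z) - nabla D (VectorField.mlieBracket J X Y) Z

/-- The covariant derivative of the curvature,
`(∇_X R)(Y, Z)W = ∇_X (R(Y, Z)W) - R(∇_X Y, Z)W - R(Y, ∇_X Z)W - R(Y, Z)(∇_X W)`. -/
def nablaCurvature (D : CovariantDerivative J F (TangentSpace J : N → Type _))
    (X Y Z W : Π x : N, TangentSpace J x) : Π x : N, TangentSpace J x :=
  nabla D X (curvature D Y Z W) - curvature D (nabla D X Y) Z W
    - curvature D Y (nabla D X Z) W - curvature D Y Z (nabla D X W)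

/-- The vector field `S(X)Y = (∇_X R)(Y, X)X`. -/
def szaboField (D : CovariantDerivative J F (TangentSpace J : N → Type _))
    (X Y : Π x : N, TangentSpace J x) : Π x : N, TangentSpace J x :=
  nablaCurvature D X Y X X

variable [FiniteDimensional ℝ F]

instance (x : N) : FiniteDimensional ℝ (TangentSpace J x) :=
  inferInstanceAs (FiniteDimensional ℝ F)

/-- The Szabó operator `S(v) : T_x N → T_x N`, `w ↦ (∇_v R)(w, v)v`, of a tangent vector `v` at
`x`. The expression `(∇_X R)(Y, X)X` is tensorial, so it is evaluated on a basis of `T_x N` by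
extending `v` and the basis vectors to vector fields that are smooth near `x`, and then extended
linearly. -/
def szaboOperator (D : CovariantDerivative J F (TangentSpace J : N → Type _))
    (x : N) (v : TangentSpace J x) : TangentSpace J x →ₗ[ℝ] TangentSpace J x :=
  (Module.finBasis ℝ (TangentSpace J x)).constr ℝ fun m =>
    szaboField D (FiberBundle.extend F v)
      (FiberBundle.extend F (Module.finBasis ℝ (TangentSpace J x) m)) x

/-- `(N, D)` is affine Szabó at `x`: all the operators `S(v)`, `v ∈ T_x N`, have the same
characteristic polynomial. -/
def IsAffineSzaboAt (D : CovariantDerivative J F (TangentSpace J : N → Type _)) (x : N) : Prop :=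
  ∀ v w : TangentSpace J x, (szaboOperator D x v).charpoly = (szaboOperator D x w).charpoly

/-- `(N, D)` is affine Szabó. -/
def IsAffineSzabo (D : CovariantDerivative J F (TangentSpace J : N → Type _)) : Prop :=
  ∀ x : N, IsAffineSzaboAt D x

end Connection

/-! ### Pseudo-Riemannian metrics -/

section Metric

variable {F : Type*} [NormedAddCommGroup F] [NormedSpace ℝ F]
  {H : Type*} [TopologicalSpace H] (J : ModelWithCorners ℝ F H)
  (N : Type*) [TopologicalSpace N] [ChartedSpace H N] [IsManifold J ∞ N]

/-- A smooth pseudo-Riemannian metric on the manifold `N`. -/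
structure PseudoRiemannianMetric where
  /-- The bilinear form on each tangent space. -/
  val (x : N) : TangentSpace J x →L[ℝ] TangentSpace J x →L[ℝ] ℝ
  symm (x : N) (v w : TangentSpace J x) : val x v w = val x w v
  nondegenerate (x : N) (v : TangentSpace J x) (hv : ∀ w, val x v w = 0) : v = 0
  contMDiff : ContMDiff J (J.prod 𝓘(ℝ, F →L[ℝ] F →L[ℝ] ℝ)) ∞
    (fun x => TotalSpace.mk' (F →L[ℝ] F →L[ℝ] ℝ)
      (E := fun x : N => TangentSpace J x →L[ℝ] TangentSpace J x →L[ℝ] ℝ) x (val x))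

variable {J N}

namespace PseudoRiemannianMetric

/-- `g` has signature `(p, q)` at every point: each tangent space has a basis of `p` vectors with
`g(e, e) = 1` and `q` vectors with `g(e, e) = -1` that are pairwise orthogonal. -/
def HasSignature (g : PseudoRiemannianMetric J N) (p q : ℕ) : Prop :=
  ∀ x : N, ∃ b : Module.Basis (Fin p ⊕ Fin q) ℝ (TangentSpace J x),
    (∀ i j, i ≠ j → g.val x (b i) (b j) = 0) ∧
    (∀ i, g.val x (b (Sum.inl i)) (b (Sum.inl i)) = 1) ∧
    (∀ i, g.val x (b (Sum.inr i)) (b (Sum.inr i)) = -1)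

variable [FiniteDimensional ℝ F]

/-- `D` is the Levi-Civita connection of `g`: it is torsion-free and metric, that is,
`u (g(Y, Z)) = g(∇_u Y, Z) + g(Y, ∇_u Z)`. On differentiable vector fields these two properties
determine `D` (by the Koszul formula), and `D` is then smooth. -/
def IsLeviCivita [CompleteSpace F] (g : PseudoRiemannianMetric J N)
    (D : CovariantDerivative J F (TangentSpace J : N → Type _)) : Prop :=
  D.torsion = 0 ∧
  ∀ (x : N) (u : TangentSpace J x) (Y Z : Π y : N, TangentSpace J y),
    MDifferentiableAt J J.tangent (fun y => (⟨y, Y y⟩ : TangentBundle J N)) x →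
    MDifferentiableAt J J.tangent (fun y => (⟨y, Z y⟩ : TangentBundle J N)) x →
    mvfderiv J (fun y => g.val y (Y y) (Z y)) x u =
      g.val x (D Y x u) (Z x) + g.val x (Y x) (D Z x u)

/-- `(N, g)` is a pseudo-Riemannian Szabó manifold: the eigenvalues (with multiplicity, that is,
the characteristic polynomial) of the Szabó operators `S(v)` of the Levi-Civita connection are
constant on the unit pseudo-sphere bundle `{g(v, v) = 1}`, and on the one `{g(v, v) = -1}`. -/
def IsSzabo [CompleteSpace F] (g : PseudoRiemannianMetric J N) : Prop :=
  ∃ D : CovariantDerivative J F (TangentSpace J : N → Type _), g.IsLeviCivita D ∧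
    ∀ ε : ℝ, ε = 1 ∨ ε = -1 →
      ∀ (x y : N) (v : TangentSpace J x) (w : TangentSpace J y),
        g.val x v v = ε → g.val y w w = ε →
          (szaboOperator D x v).charpoly = (szaboOperator D y w).charpoly

end PseudoRiemannianMetric

end Metric

/-! ### The cotangent bundle and the Riemannian extension -/

section Cotangent

variable (E : Type*) [NormedAddCommGroup E] [NormedSpace ℝ E]
  (M : Type*) [TopologicalSpace M] [ChartedSpace E M] [IsManifold 𝓘(ℝ, E) ∞ M]

/-- The total space `T*M` of the cotangent bundle. -/
abbrev Cotangent : Type _ :=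
  TotalSpace (E →L[ℝ] ℝ) (fun x : M => TangentSpace 𝓘(ℝ, E) x →L[ℝ] ℝ)

variable {E M}

/-- The coordinate vector field `∂_a` of the chart `c` in the constant direction `a`
(`∂_i` if `a` is the `i`-th vector of a basis of `E`), defined on the domain of `c`. -/
def coordField (c : OpenPartialHomeomorph M E) (a : E) (p : M) : TangentSpace 𝓘(ℝ, E) p :=
  (mfderiv 𝓘(ℝ, E) 𝓘(ℝ, E) c p).inverse a

/-- The inverse of the coordinate system on `T*M` induced by the chart `c` of `M`: the point with
coordinates `(u, ξ)` is the covector `ξ ∘ dc` at the point `c⁻¹(u)`. -/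
def inducedChartSymm (c : OpenPartialHomeomorph M E) (z : E × (E →L[ℝ] ℝ)) : Cotangent E M :=
  ⟨c.symm z.1, z.2 ∘L mfderiv 𝓘(ℝ, E) 𝓘(ℝ, E) c (c.symm z.1)⟩

/-- The coordinate tangent vector to `T*M` with components `(a, α)` in the coordinate system
induced by `c`, at the point with coordinates `z`. -/
def inducedCoordVector (c : OpenPartialHomeomorph M E) (z t : E × (E →L[ℝ] ℝ)) :
    TangentSpace (𝓘(ℝ, E).prod 𝓘(ℝ, E →L[ℝ] ℝ)) (inducedChartSymm c z) :=
  mfderiv 𝓘(ℝ, E × (E →L[ℝ] ℝ)) (𝓘(ℝ, E).prod 𝓘(ℝ, E →L[ℝ] ℝ)) (inducedChartSymm c) z t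

/-- The Christoffel symbols of `D` in the chart `c`: `Γ(u)(a, b) ∈ E` is the coordinate expression
at `c⁻¹(u)` of `∇_{∂_a} ∂_b`. -/
def christoffel (D : CovariantDerivative 𝓘(ℝ, E) E (TangentSpace 𝓘(ℝ, E) : M → Type _))
    (c : OpenPartialHomeomorph M E) (u a b : E) : E :=
  mfderiv 𝓘(ℝ, E) 𝓘(ℝ, E) c (c.symm u) (nabla D (coordField c a) (coordField c b) (c.symm u))

/-- `g` is the Riemannian extension of `D`: in the coordinates `(u, ξ)` induced on `T*M` by any
chart of (the smooth structure of) `M`, its matrix is `[[-2 ξ_k Γ^k_ij, δ], [δ, 0]]`. -/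
def IsRiemannianExtension
    (D : CovariantDerivative 𝓘(ℝ, E) E (TangentSpace 𝓘(ℝ, E) : M → Type _))
    (g : PseudoRiemannianMetric (𝓘(ℝ, E).prod 𝓘(ℝ, E →L[ℝ] ℝ)) (Cotangent E M)) : Prop :=
  ∀ c ∈ IsManifold.maximalAtlas 𝓘(ℝ, E) ∞ M, ∀ u ∈ c.target, ∀ ξ : E →L[ℝ] ℝ,
    ∀ (a b : E) (α β : E →L[ℝ] ℝ),
      g.val (inducedChartSymm c (u, ξ))
          (inducedCoordVector c (u, ξ) (a, α)) (inducedCoordVector c (u, ξ) (b, β)) =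
        -2 * ξ (christoffel D c u a b) + α b + β a

end Cotangent

end SzaboGeometry

end

/-! In induced coordinates a tangent vector of `T*M` is a pair `(a, α)` of a base component and a
covector component. Solving the metric equation gives Christoffel symbols `extChristoffel` for the
Riemannian extension, and their base component is `Γ` itself. Curvature and its covariant derivative
therefore project to those of `∇`: the base component of the Szabó operator of `(a, α)` applied to
`(b, β)` is `S(a)b`. In particular vertical vectors stay vertical, and on them the operator is the
transpose of `S(a)`; this rests on the pair symmetry of a metric curvature tensor, made explicit in
`riem_extChristoffel_vert` and carried to the Szabó operator in `localSzabo_extChristoffel_vert`.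
The operator is thus block triangular with diagonal blocks `S(a)` and `S(a)ᵀ`, and its
characteristic polynomial is the square of that of `S(a)`, whatever `α` and the covector at the foot
are (`charpoly_prod_dual`).

The other ingredient is homogeneity: `S(rv) = r³ S(v)`. If `S(2v)` and `S(v)` have the same
characteristic polynomial, scaling kills every coefficient but the leading one, so `S(v)` has
characteristic polynomial `X ^ n` (`charpoly_eq_X_pow_of_smul`). Affine Szabó is therefore
nilpotency of all `S(v)`, and then every Szabó operator on `T*M` has characteristic polynomial `X ^
(2n)`. Conversely, at the zero covector `g(V, V) = 2 α(a)` for `V = (a, α)`, so unit vectors lie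
over both `v` and `2v` when `v ≠ 0`. The Szabó condition equates the squares of the two
characteristic polynomials, and monic real polynomials with equal squares are equal.

The metric is well defined because the second derivatives of a coordinate change, entering through
the Christoffel symbols with factor `-2`, are offset by those that the induced change of covector
components contributes to `α b` and to `β a` (`extForm_cotangentTransition`). The passage from
manifold to coordinates goes through `HasChristoffel`. By the Koszul argument every Levi-Civita
connection of the extension has the symbols `extChristoffel`, so all Szabó operators are computed by
`localSzabo`. -/

noncomputable section

set_option maxSynthPendingDepth 3

namespace SzaboGeometry

/-! ### Connections on open subsets of a vector space -/

section Apply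

variable {V W : Type*} [NormedAddCommGroup V] [NormedSpace ℝ V] [NormedAddCommGroup W]
  [NormedSpace ℝ W]

/-! Versions of `add_apply` and so on that need no search for `FunLike` instances. -/

lemma clm_add_apply (f g : V →L[ℝ] W) (x : V) : (f + g) x = f x + g x := rfl

lemma clm_sub_apply (f g : V →L[ℝ] W) (x : V) : (f - g) x = f x - g x := rfl

lemma clm_neg_apply (f : V →L[ℝ] W) (x : V) : (-f) x = -f x := rfl

lemma clm_smul_apply (f : V →L[ℝ] W) (r : ℝ) (x : V) : (r • f) x = r • f x := rfl

end Apply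

section Local

variable {F : Type*} [NormedAddCommGroup F] [NormedSpace ℝ F]

/-- `∇_X Y` for the connection on (an open subset of) `F` with Christoffel symbols `Γ`. -/
def localNabla (Γ : F → F →L[ℝ] F →L[ℝ] F) (X Y : F → F) (u : F) : F :=
  fderiv ℝ Y u (X u) + Γ u (X u) (Y u)

/-- The curvature of the connection with Christoffel symbols `Γ`, on vector fields. -/
def localCurvature (Γ : F → F →L[ℝ] F →L[ℝ] F) (X Y Z : F → F) (u : F) : F :=
  localNabla Γ X (localNabla Γ Y Z) u - localNabla Γ Y (localNabla Γ X Z) u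
    - localNabla Γ (VectorField.lieBracket ℝ X Y) Z u

/-- The curvature tensor of the connection with Christoffel symbols `Γ`. -/
def riem (Γ : F → F →L[ℝ] F →L[ℝ] F) (u a b c : F) : F :=
  fderiv ℝ Γ u a b c - fderiv ℝ Γ u b a c + Γ u a (Γ u b c) - Γ u b (Γ u a c)

/-- The Szabó operator `b ↦ (∇_a R)(b, a)a` of the connection with Christoffel symbols `Γ`. -/
def localSzabo (Γ : F → F →L[ℝ] F →L[ℝ] F) (u a b : F) : F :=
  fderiv ℝ (fun y => riem Γ y b a a) u a + Γ u a (riem Γ u b a a)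
    - riem Γ u (Γ u a b) a a - riem Γ u b (Γ u a a) a - riem Γ u b a (Γ u a a)

variable {Γ : F → F →L[ℝ] F →L[ℝ] F} {U : Set F}

lemma riem_swap (u a b c : F) : riem Γ u a b c = -riem Γ u b a c := by
  simp only [riem]; abel

lemma contDiffOn_fderiv_apply {G : Type*} [NormedAddCommGroup G] [NormedSpace ℝ G]
    {f : F → G} {X : F → F} (hU : IsOpen U) (hf : ContDiffOn ℝ ∞ f U) (hX : ContDiffOn ℝ ∞ X U) :
    ContDiffOn ℝ ∞ (fun u => fderiv ℝ f u (X u)) U :=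
  (hf.fderiv_of_isOpen hU (by simp)).clm_apply hX

lemma contDiffOn_localNabla (hU : IsOpen U) (hΓ : ContDiffOn ℝ ∞ Γ U) {X Y : F → F}
    (hX : ContDiffOn ℝ ∞ X U) (hY : ContDiffOn ℝ ∞ Y U) :
    ContDiffOn ℝ ∞ (localNabla Γ X Y) U :=
  (contDiffOn_fderiv_apply hU hY hX).add ((hΓ.clm_apply hX).clm_apply hY)

lemma contDiffOn_riem (hU : IsOpen U) (hΓ : ContDiffOn ℝ ∞ Γ U) {X Y Z : F → F}
    (hX : ContDiffOn ℝ ∞ X U) (hY : ContDiffOn ℝ ∞ Y U) (hZ : ContDiffOn ℝ ∞ Z U) :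
    ContDiffOn ℝ ∞ (fun u => riem Γ u (X u) (Y u) (Z u)) U := by
  have h := hΓ.fderiv_of_isOpen hU (m := ∞) (by simp)
  exact ((((h.clm_apply hX).clm_apply hY).clm_apply hZ).sub
    (((h.clm_apply hY).clm_apply hX).clm_apply hZ)).add
    ((hΓ.clm_apply hX).clm_apply ((hΓ.clm_apply hY).clm_apply hZ)) |>.sub
    ((hΓ.clm_apply hY).clm_apply ((hΓ.clm_apply hX).clm_apply hZ))

lemma contDiffOn_lieBracket (hU : IsOpen U) {X Y : F → F}
    (hX : ContDiffOn ℝ ∞ X U) (hY : ContDiffOn ℝ ∞ Y U) :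
    ContDiffOn ℝ ∞ (VectorField.lieBracket ℝ X Y) U :=
  (contDiffOn_fderiv_apply hU hY hX).sub (contDiffOn_fderiv_apply hU hX hY)

lemma _root_.ContDiffOn.differentiableAt_of_isOpen {G : Type*} [NormedAddCommGroup G]
    [NormedSpace ℝ G] {f : F → G} (hf : ContDiffOn ℝ ∞ f U) (hU : IsOpen U) {u : F} (hu : u ∈ U) :
    DifferentiableAt ℝ f u :=
  (hf.contDiffAt (hU.mem_nhds hu)).differentiableAt (by simp)

lemma fderiv_localNabla (hU : IsOpen U) (hΓ : ContDiffOn ℝ ∞ Γ U) {X Y : F → F}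
    (hX : ContDiffOn ℝ ∞ X U) (hY : ContDiffOn ℝ ∞ Y U) {u : F} (hu : u ∈ U) (v : F) :
    fderiv ℝ (localNabla Γ X Y) u v =
      fderiv ℝ (fderiv ℝ Y) u v (X u) + fderiv ℝ Y u (fderiv ℝ X u v)
      + (fderiv ℝ Γ u v (X u) (Y u) + Γ u (fderiv ℝ X u v) (Y u)
        + Γ u (X u) (fderiv ℝ Y u v)) := by
  have hX' := hX.differentiableAt_of_isOpen hU hu
  have hY' := hY.differentiableAt_of_isOpen hU hu
  have hΓ' := hΓ.differentiableAt_of_isOpen hU hu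
  have hY'' : DifferentiableAt ℝ (fderiv ℝ Y) u :=
    (hY.fderiv_of_isOpen hU (m := ∞) (by simp)).differentiableAt_of_isOpen hU hu
  have h := ((hY''.hasFDerivAt.clm_apply hX'.hasFDerivAt).add
    ((hΓ'.hasFDerivAt.clm_apply hX'.hasFDerivAt).clm_apply hY'.hasFDerivAt))
  have h2 : HasFDerivAt (localNabla Γ X Y) _ u := h
  rw [h2.fderiv]
  simp
  abel

/-- Tensoriality of the curvature: after the product rule the derivatives of `X` and `Y` cancel
against the bracket term, the first derivatives of `Z` cancel by antisymmetry, and the second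
derivatives of `Z` by their symmetry. Only the values at `u` survive. -/
lemma localCurvature_eq_riem (hU : IsOpen U) (hΓ : ContDiffOn ℝ ∞ Γ U) {X Y Z : F → F}
    (hX : ContDiffOn ℝ ∞ X U) (hY : ContDiffOn ℝ ∞ Y U) (hZ : ContDiffOn ℝ ∞ Z U)
    {u : F} (hu : u ∈ U) :
    localCurvature Γ X Y Z u = riem Γ u (X u) (Y u) (Z u) := by
  have hs : IsSymmSndFDerivAt ℝ Z u :=
    (hZ.contDiffAt (hU.mem_nhds hu)).isSymmSndFDerivAt
      (by simpa using WithTop.coe_le_coe.2 (le_top (a := (2 : ℕ∞))))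
  have := hs (X u) (Y u)
  have e (A B : F → F) : localNabla Γ A B u = fderiv ℝ B u (A u) + Γ u (A u) (B u) := rfl
  simp only [localCurvature, riem]
  rw [e X, e Y, e (VectorField.lieBracket ℝ X Y), e Y, e X, fderiv_localNabla hU hΓ hY hZ hu,
    fderiv_localNabla hU hΓ hX hZ hu]
  simp only [VectorField.lieBracket, VectorField.lieBracket, ContinuousLinearMap.map_add,
    ContinuousLinearMap.map_sub, clm_sub_apply,
    this]
  abel

/-- `localSzabo` is what the definition of the Szabó operator gives on constant vector fields. -/
lemma localSzabo_eq (hU : IsOpen U) (hΓ : ContDiffOn ℝ ∞ Γ U) {u : F} (hu : u ∈ U) (a b : F)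
    (A B : F → F) (hA : A = fun _ => a) (hB : B = fun _ => b) :
    localNabla Γ A (localCurvature Γ B A A) u - localCurvature Γ (localNabla Γ A B) A A u
      - localCurvature Γ B (localNabla Γ A A) A u - localCurvature Γ B A (localNabla Γ A A) u
      = localSzabo Γ u a b := by
  subst hA hB
  have ha : ContDiffOn ℝ ∞ (fun _ : F => a) U := contDiffOn_const
  have hb : ContDiffOn ℝ ∞ (fun _ : F => b) U := contDiffOn_const
  rw [localCurvature_eq_riem hU hΓ (contDiffOn_localNabla hU hΓ ha hb) ha ha hu,
    localCurvature_eq_riem hU hΓ hb (contDiffOn_localNabla hU hΓ ha ha) ha hu,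
    localCurvature_eq_riem hU hΓ hb ha (contDiffOn_localNabla hU hΓ ha ha) hu]
  have h1 : localCurvature Γ (fun _ => b) (fun _ => a) (fun _ => a) =ᶠ[nhds u]
      fun y => riem Γ y b a a := by
    filter_upwards [hU.mem_nhds hu] with y hy
    exact localCurvature_eq_riem hU hΓ hb ha ha hy
  simp [localNabla, localSzabo, h1.fderiv_eq, h1.eq_of_nhds]

lemma riem_add_left (u a a' b c : F) :
    riem Γ u (a + a') b c = riem Γ u a b c + riem Γ u a' b c := by
  simp only [riem, ContinuousLinearMap.map_add, clm_add_apply]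
  abel

lemma riem_smul (u a b c : F) (r s t : ℝ) :
    riem Γ u (r • a) (s • b) (t • c) = (r * s * t) • riem Γ u a b c := by
  simp only [riem, ContinuousLinearMap.map_smul, clm_smul_apply]
  module

lemma differentiableAt_riem (hU : IsOpen U) (hΓ : ContDiffOn ℝ ∞ Γ U) {u : F} (hu : u ∈ U)
    (a b c : F) : DifferentiableAt ℝ (fun y => riem Γ y a b c) u :=
  (contDiffOn_riem hU hΓ (X := fun _ => a) (Y := fun _ => b) (Z := fun _ => c)
    contDiffOn_const contDiffOn_const contDiffOn_const).differentiableAt_of_isOpen hU hu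

/-- `localSzabo` as a linear map. -/
def localSzaboLin (hU : IsOpen U) (hΓ : ContDiffOn ℝ ∞ Γ U) {u : F} (hu : u ∈ U) (a : F) :
    F →ₗ[ℝ] F where
  toFun := localSzabo Γ u a
  map_add' b c := by
    have h1 : fderiv ℝ (fun y => riem Γ y (b + c) a a) u =
        fderiv ℝ (fun y => riem Γ y b a a) u + fderiv ℝ (fun y => riem Γ y c a a) u := by
      simp only [riem_add_left]
      exact fderiv_fun_add (differentiableAt_riem hU hΓ hu b a a)
        (differentiableAt_riem hU hΓ hu c a a)
    rw [localSzabo, h1]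
    simp only [localSzabo, riem_add_left, ContinuousLinearMap.map_add, clm_add_apply]
    abel
  map_smul' r b := by
    have e (u b a c : F) : riem Γ u (r • b) a c = r • riem Γ u b a c := by
      simpa using riem_smul (Γ := Γ) u b a c r 1 1
    have h1 : fderiv ℝ (fun y => riem Γ y (r • b) a a) u =
        r • fderiv ℝ (fun y => riem Γ y b a a) u := by
      simp only [e]
      exact fderiv_fun_const_smul (differentiableAt_riem hU hΓ hu b a a) r
    rw [localSzabo, h1]
    simp only [localSzabo, e, ContinuousLinearMap.map_smul, clm_smul_apply, RingHom.id_apply,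
      smul_sub, smul_add]

@[simp]
lemma localSzaboLin_apply (hU : IsOpen U) (hΓ : ContDiffOn ℝ ∞ Γ U) {u : F} (hu : u ∈ U)
    (a b : F) : localSzaboLin hU hΓ hu a b = localSzabo Γ u a b := rfl

/-- The vector `a` enters three times: as direction of differentiation and in two slots of the
curvature. This cubic scaling is what forces nilpotency in the affine Szabó condition. -/
lemma localSzabo_smul_left (hU : IsOpen U) (hΓ : ContDiffOn ℝ ∞ Γ U) {u : F} (hu : u ∈ U)
    (r : ℝ) (a b : F) : localSzabo Γ u (r • a) b = r ^ 3 • localSzabo Γ u a b := by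
  have e (y a b c : F) (s t : ℝ) : riem Γ y a (s • b) (t • c) = (s * t) • riem Γ y a b c := by
    simpa using riem_smul (Γ := Γ) y a b c 1 s t
  have h1 : fderiv ℝ (fun y => riem Γ y b (r • a) (r • a)) u =
      (r * r) • fderiv ℝ (fun y => riem Γ y b a a) u := by
    simp only [e]
    exact fderiv_fun_const_smul (differentiableAt_riem hU hΓ hu b a a) _
  have e1 : riem Γ u (Γ u (r • a) b) (r • a) (r • a) = r ^ 3 • riem Γ u (Γ u a b) a a := by
    rw [map_smul, clm_smul_apply, riem_smul]; module
  have e2 : riem Γ u b (Γ u (r • a) (r • a)) (r • a) = r ^ 3 • riem Γ u b (Γ u a a) a := by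
    rw [map_smul, ContinuousLinearMap.map_smul, clm_smul_apply, smul_smul, e]; module
  have e3 : riem Γ u b (r • a) (Γ u (r • a) (r • a)) = r ^ 3 • riem Γ u b a (Γ u a a) := by
    rw [map_smul, ContinuousLinearMap.map_smul, clm_smul_apply, smul_smul, e]; module
  rw [localSzabo, h1, e, e1, e2, e3, localSzabo]
  simp only [ContinuousLinearMap.map_smul, clm_smul_apply]
  module

end Local

/-! ### The Riemannian extension in coordinates -/

section LocalExtension

variable {E : Type*} [NormedAddCommGroup E] [NormedSpace ℝ E]

/-- The form `-2 ξ(B(a, b)) + α b + β a` on `E × E*`. -/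
def extForm (ξ : E →L[ℝ] ℝ) (B : E →L[ℝ] E →L[ℝ] E) :
    E × (E →L[ℝ] ℝ) →L[ℝ] E × (E →L[ℝ] ℝ) →L[ℝ] ℝ :=
  let fst := ContinuousLinearMap.fst ℝ E (E →L[ℝ] ℝ)
  let snd := ContinuousLinearMap.snd ℝ E (E →L[ℝ] ℝ)
  (-2 : ℝ) • (((ContinuousLinearMap.compL ℝ E E ℝ ξ) ∘L B).bilinearComp fst fst)
    + (ContinuousLinearMap.id ℝ (E →L[ℝ] ℝ)).bilinearComp snd fst
    + (ContinuousLinearMap.id ℝ (E →L[ℝ] ℝ)).flip.bilinearComp fst snd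

lemma extForm_apply (ξ : E →L[ℝ] ℝ) (B : E →L[ℝ] E →L[ℝ] E) (v w : E × (E →L[ℝ] ℝ)) :
    extForm ξ B v w = -2 * ξ (B v.1 w.1) + v.2 w.1 + w.2 v.1 := by
  simp [extForm]

lemma extForm_symm (ξ : E →L[ℝ] ℝ) {B : E →L[ℝ] E →L[ℝ] E} (hB : ∀ a b, B a b = B b a)
    (v w : E × (E →L[ℝ] ℝ)) : extForm ξ B v w = extForm ξ B w v := by
  rw [extForm_apply, extForm_apply, hB]; ring

/-- The covectors `(0, f)` detect the base component; once it vanishes, the vectors `(w, 0)` read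
off the covector component. -/
lemma extForm_nondegenerate (ξ : E →L[ℝ] ℝ) (B : E →L[ℝ] E →L[ℝ] E) (v : E × (E →L[ℝ] ℝ))
    (hv : ∀ w, extForm ξ B v w = 0) : v = 0 := by
  have h1 : v.1 = 0 := by
    by_contra h
    obtain ⟨f, -, hf⟩ := exists_dual_vector ℝ v.1 (norm_ne_zero_iff.2 h)
    have := hv (0, f)
    simp only [extForm_apply, map_zero] at this
    simp [hf, h] at this
  have h2 : v.2 = 0 := by
    ext w
    have := hv (w, 0)
    simpa [extForm_apply, h1] using this
  exact Prod.ext h1 h2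

/-- The covector component of `extChristoffel`. -/
def extChristoffelSnd (Γ : E → E →L[ℝ] E →L[ℝ] E) (z A B : E × (E →L[ℝ] ℝ)) : E →L[ℝ] ℝ :=
  - A.2 ∘L Γ z.1 B.1 - B.2 ∘L Γ z.1 A.1
      - z.2 ∘L (fderiv ℝ Γ z.1 A.1 B.1 + fderiv ℝ Γ z.1 B.1 A.1
        - ((fderiv ℝ Γ z.1).flip A.1).flip B.1 - (2 : ℝ) • Γ z.1 (Γ z.1 A.1 B.1))

lemma extChristoffelSnd_apply (Γ : E → E →L[ℝ] E →L[ℝ] E) (z A B : E × (E →L[ℝ] ℝ)) (c : E) :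
    extChristoffelSnd Γ z A B c = - A.2 (Γ z.1 B.1 c) - B.2 (Γ z.1 A.1 c)
      - z.2 (fderiv ℝ Γ z.1 A.1 B.1 c + fderiv ℝ Γ z.1 B.1 A.1 c
        - fderiv ℝ Γ z.1 c A.1 B.1 - (2 : ℝ) • Γ z.1 (Γ z.1 A.1 B.1) c) := rfl

variable {Γ : E → E →L[ℝ] E →L[ℝ] E} {U : Set E}

lemma fderiv_extForm {u : E} (hΓ : DifferentiableAt ℝ Γ u) (ξ : E →L[ℝ] ℝ)
    (C A B : E × (E →L[ℝ] ℝ)) :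
    fderiv ℝ (fun z : E × (E →L[ℝ] ℝ) => extForm z.2 (Γ z.1) A B) (u, ξ) C =
      -2 * (C.2 (Γ u A.1 B.1) + ξ (fderiv ℝ Γ u C.1 A.1 B.1)) := by
  have h1 : HasFDerivAt (fun z : E × (E →L[ℝ] ℝ) => Γ z.1)
      ((fderiv ℝ Γ u) ∘L ContinuousLinearMap.fst ℝ E (E →L[ℝ] ℝ)) (u, ξ) :=
    HasFDerivAt.comp (g := Γ) (u, ξ) hΓ.hasFDerivAt hasFDerivAt_fst
  have h2 := (h1.clm_apply (hasFDerivAt_const A.1 (u, ξ))).clm_apply (hasFDerivAt_const B.1 (u, ξ))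
  have h3 := (((hasFDerivAt_snd (𝕜 := ℝ) (p := (u, ξ))).clm_apply h2).const_mul (-2)).add_const
    (A.2 B.1 + B.2 A.1)
  have h4 : (fun z : E × (E →L[ℝ] ℝ) => extForm z.2 (Γ z.1) A B) =
      fun z => -2 * z.2 (Γ z.1 A.1 B.1) + (A.2 B.1 + B.2 A.1) := by
    ext z; rw [extForm_apply]; ring
  rw [h4, h3.fderiv]
  simp
  ring

variable [FiniteDimensional ℝ E]

/-- The Christoffel symbols of the Riemannian extension of the connection with symbols `Γ`. -/
def extChristoffel (Γ : E → E →L[ℝ] E →L[ℝ] E) (z : E × (E →L[ℝ] ℝ)) :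
    E × (E →L[ℝ] ℝ) →L[ℝ] E × (E →L[ℝ] ℝ) →L[ℝ] E × (E →L[ℝ] ℝ) :=
  LinearMap.toContinuousBilinearMap <|
    LinearMap.mk₂ ℝ (fun A B => (Γ z.1 A.1 B.1, extChristoffelSnd Γ z A B))
    (by
      intro A A' B
      refine Prod.ext ?_ (ContinuousLinearMap.ext fun c => ?_)
      · simp only [Prod.fst_add, ContinuousLinearMap.map_add, clm_add_apply]
      · simp only [Prod.snd_add, Prod.fst_add, clm_add_apply, extChristoffelSnd_apply,
        ContinuousLinearMap.map_add,
          ContinuousLinearMap.map_sub, ContinuousLinearMap.map_smul, smul_eq_mul]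
        ring)
    (by
      intro r A B
      refine Prod.ext ?_ (ContinuousLinearMap.ext fun c => ?_)
      · simp only [Prod.smul_fst, ContinuousLinearMap.map_smul, clm_smul_apply]
      · simp only [Prod.smul_snd, Prod.smul_fst, clm_smul_apply, extChristoffelSnd_apply,
        ContinuousLinearMap.map_add,
          ContinuousLinearMap.map_sub, ContinuousLinearMap.map_smul, smul_eq_mul]
        ring)
    (by
      intro A B B'
      refine Prod.ext ?_ (ContinuousLinearMap.ext fun c => ?_)
      · simp only [Prod.fst_add, ContinuousLinearMap.map_add]
      · simp only [Prod.snd_add, Prod.fst_add, clm_add_apply, extChristoffelSnd_apply,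
        ContinuousLinearMap.map_add,
          ContinuousLinearMap.map_sub, ContinuousLinearMap.map_smul, smul_eq_mul]
        ring)
    (by
      intro r A B
      refine Prod.ext ?_ (ContinuousLinearMap.ext fun c => ?_)
      · simp only [Prod.smul_fst, ContinuousLinearMap.map_smul]
      · simp only [Prod.smul_snd, Prod.smul_fst, clm_smul_apply, extChristoffelSnd_apply,
        ContinuousLinearMap.map_add,
          ContinuousLinearMap.map_sub, ContinuousLinearMap.map_smul, smul_eq_mul]
        ring)

lemma extChristoffel_fst (Γ : E → E →L[ℝ] E →L[ℝ] E) (z A B : E × (E →L[ℝ] ℝ)) :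
    (extChristoffel Γ z A B).1 = Γ z.1 A.1 B.1 := rfl

lemma extChristoffel_snd_apply (Γ : E → E →L[ℝ] E →L[ℝ] E) (z A B : E × (E →L[ℝ] ℝ)) (c : E) :
    (extChristoffel Γ z A B).2 c = - A.2 (Γ z.1 B.1 c) - B.2 (Γ z.1 A.1 c)
      - z.2 (fderiv ℝ Γ z.1 A.1 B.1 c + fderiv ℝ Γ z.1 B.1 A.1 c
        - fderiv ℝ Γ z.1 c A.1 B.1 - (2 : ℝ) • Γ z.1 (Γ z.1 A.1 B.1) c) := rfl

/-- In finite dimension smoothness of an operator-valued map can be tested on fixed arguments, where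
the formula is a polynomial expression in `Γ`, its derivative and the fibre variable. -/
lemma contDiffOn_extChristoffel (hU : IsOpen U) (hΓ : ContDiffOn ℝ ∞ Γ U) :
    ContDiffOn ℝ ∞ (extChristoffel Γ) (U ×ˢ Set.univ) := by
  have h1 : ContDiffOn ℝ ∞ (fun z : E × (E →L[ℝ] ℝ) => Γ z.1) (U ×ˢ Set.univ) :=
    hΓ.comp contDiffOn_fst fun z hz => hz.1
  have h2 : ContDiffOn ℝ ∞ (fun z : E × (E →L[ℝ] ℝ) => fderiv ℝ Γ z.1) (U ×ˢ Set.univ) :=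
    (hΓ.fderiv_of_isOpen hU (m := ∞) (by simp)).comp contDiffOn_fst fun z hz => hz.1
  have ev (a b : E) := (h1.clm_apply (contDiffOn_const (c := a))).clm_apply
    (contDiffOn_const (c := b))
  have ev2 (a b c : E) := ((h2.clm_apply (contDiffOn_const (c := a))).clm_apply
    (contDiffOn_const (c := b))).clm_apply (contDiffOn_const (c := c))
  refine contDiffOn_clm_apply.2 fun A => contDiffOn_clm_apply.2 fun B => ?_
  refine ContDiffOn.prodMk (ev A.1 B.1) (contDiffOn_clm_apply.2 fun c => ?_)
  exact ((contDiffOn_const (c := A.2).clm_apply (ev B.1 c)).neg.sub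
    (contDiffOn_const (c := B.2).clm_apply (ev A.1 c))).sub
    (contDiffOn_snd.clm_apply ((((ev2 A.1 B.1 c).add (ev2 B.1 A.1 c)).sub (ev2 c A.1 B.1)).sub
      (contDiffOn_const.smul ((h1.clm_apply (ev A.1 B.1)).clm_apply contDiffOn_const))))

/-- The connection `extChristoffel Γ` is metric. -/
lemma fderiv_extForm_eq {u : E} (hΓ : DifferentiableAt ℝ Γ u) (ξ : E →L[ℝ] ℝ)
    (hsymm : ∀ a b, Γ u a b = Γ u b a) (hsymm' : ∀ c a b, fderiv ℝ Γ u c a b = fderiv ℝ Γ u c b a)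
    (C A B : E × (E →L[ℝ] ℝ)) :
    fderiv ℝ (fun z : E × (E →L[ℝ] ℝ) => extForm z.2 (Γ z.1) A B) (u, ξ) C =
      extForm ξ (Γ u) (extChristoffel Γ (u, ξ) C A) B +
        extForm ξ (Γ u) A (extChristoffel Γ (u, ξ) C B) := by
  rw [fderiv_extForm hΓ, extForm_apply, extForm_apply, extChristoffel_fst, extChristoffel_fst,
    extChristoffel_snd_apply, extChristoffel_snd_apply]
  simp only [ContinuousLinearMap.map_add, ContinuousLinearMap.map_sub,
    ContinuousLinearMap.map_smul, smul_eq_mul]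
  -- The term `2 Γ(Γ(·,·),·)` of the symbols cancels the `-2 ξ(Γ(Γ(·,·),·))` of the form. The terms
  -- in `A.2` and `B.2` cancel between the two summands, as do the derivatives of `Γ` along `A` and
  -- `B`, leaving those along `C` twice.
  rw [hsymm (Γ u C.1 A.1) B.1, hsymm (Γ u C.1 B.1) A.1, hsymm B.1 A.1,
    hsymm' C.1 B.1 A.1, hsymm' B.1 C.1 A.1, hsymm' A.1 C.1 B.1]
  ring

lemma extChristoffel_symm {z : E × (E →L[ℝ] ℝ)} (hsymm : ∀ a b, Γ z.1 a b = Γ z.1 b a)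
    (hsymm' : ∀ c a b, fderiv ℝ Γ z.1 c a b = fderiv ℝ Γ z.1 c b a) (A B : E × (E →L[ℝ] ℝ)) :
    extChristoffel Γ z A B = extChristoffel Γ z B A := by
  refine Prod.ext (hsymm _ _) (ContinuousLinearMap.ext fun c => ?_)
  rw [extChristoffel_snd_apply, extChristoffel_snd_apply, hsymm A.1 B.1, hsymm' c A.1 B.1]
  simp only [ContinuousLinearMap.map_add, ContinuousLinearMap.map_sub]
  ring

end LocalExtension

section LocalExtension

variable {E : Type*} [NormedAddCommGroup E] [NormedSpace ℝ E] [FiniteDimensional ℝ E]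
  {Γ : E → E →L[ℝ] E →L[ℝ] E} {U : Set E}

lemma fderiv_clm_apply_apply {V W X : Type*} [NormedAddCommGroup V] [NormedSpace ℝ V]
    [NormedAddCommGroup W] [NormedSpace ℝ W] [NormedAddCommGroup X] [NormedSpace ℝ X]
    {f : V → W →L[ℝ] W →L[ℝ] X} {z : V}
    (hf : DifferentiableAt ℝ f z) (v : V) (a b : W) :
    fderiv ℝ f z v a b = fderiv ℝ (fun y => f y a b) z v := by
  have := (hf.hasFDerivAt.clm_apply (hasFDerivAt_const a z)).clm_apply (hasFDerivAt_const b z)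
  rw [this.fderiv]
  simp

lemma fderiv_fst_comp {V W W' : Type*} [NormedAddCommGroup V] [NormedSpace ℝ V]
    [NormedAddCommGroup W] [NormedSpace ℝ W] [NormedAddCommGroup W'] [NormedSpace ℝ W']
    {f : V → W × W'} {z : V} (hf : DifferentiableAt ℝ f z) (v : V) :
    (fderiv ℝ f z v).1 = fderiv ℝ (fun y => (f y).1) z v := by
  rw [fderiv.fst hf]; rfl

lemma fderiv_snd_comp_apply {V W X : Type*} [NormedAddCommGroup V] [NormedSpace ℝ V]
    [NormedAddCommGroup W] [NormedSpace ℝ W] [NormedAddCommGroup X] [NormedSpace ℝ X]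
    {f : V → W × (X →L[ℝ] ℝ)} {z : V} (hf : DifferentiableAt ℝ f z) (v : V) (c : X) :
    (fderiv ℝ f z v).2 c = fderiv ℝ (fun y => (f y).2 c) z v := by
  have := hf.hasFDerivAt.snd.clm_apply (hasFDerivAt_const c z)
  rw [this.fderiv]
  simp

lemma fderiv_comp_fst {V V' W : Type*} [NormedAddCommGroup V] [NormedSpace ℝ V]
    [NormedAddCommGroup W] [NormedSpace ℝ W] [NormedAddCommGroup V'] [NormedSpace ℝ V']
    {f : V → W} {z : V × V'} (hf : DifferentiableAt ℝ f z.1) (v : V × V') :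
    fderiv ℝ (fun y : V × V' => f y.1) z v = fderiv ℝ f z.1 v.1 := by
  have : HasFDerivAt (fun y : V × V' => f y.1) _ z := hf.hasFDerivAt.comp z hasFDerivAt_fst
  rw [this.fderiv]; rfl

lemma differentiableAt_extChristoffel (hU : IsOpen U) (hΓ : ContDiffOn ℝ ∞ Γ U)
    {z : E × (E →L[ℝ] ℝ)} (hz : z.1 ∈ U) : DifferentiableAt ℝ (extChristoffel Γ) z :=
  (contDiffOn_extChristoffel hU hΓ).differentiableAt_of_isOpen (hU.prod isOpen_univ)
    ⟨hz, trivial⟩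

lemma fderiv_extChristoffel_fst (hU : IsOpen U) (hΓ : ContDiffOn ℝ ∞ Γ U)
    {z : E × (E →L[ℝ] ℝ)} (hz : z.1 ∈ U) (A B C : E × (E →L[ℝ] ℝ)) :
    (fderiv ℝ (extChristoffel Γ) z A B C).1 = fderiv ℝ Γ z.1 A.1 B.1 C.1 := by
  have hd := differentiableAt_extChristoffel hU hΓ hz
  have hΓd := hΓ.differentiableAt_of_isOpen hU hz
  rw [fderiv_clm_apply_apply hd, fderiv_clm_apply_apply hΓd, fderiv_fst_comp]
  · exact fderiv_comp_fst (f := fun u => Γ u B.1 C.1)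
      ((hΓd.clm_apply (differentiableAt_const _)).clm_apply (differentiableAt_const _)) A
  · exact (hd.clm_apply (differentiableAt_const _)).clm_apply (differentiableAt_const _)

/-- The curvature of the Riemannian extension projects to the curvature of `Γ`. -/
lemma riem_extChristoffel_fst (hU : IsOpen U) (hΓ : ContDiffOn ℝ ∞ Γ U)
    {z : E × (E →L[ℝ] ℝ)} (hz : z.1 ∈ U) (A B C : E × (E →L[ℝ] ℝ)) :
    (riem (extChristoffel Γ) z A B C).1 = riem Γ z.1 A.1 B.1 C.1 := by
  simp only [riem, Prod.fst_add, Prod.fst_sub, fderiv_extChristoffel_fst hU hΓ hz,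
    extChristoffel_fst]

/-- The symbols are affine in the fibre variable, so the derivative along the line `t ↦ (z.1, z.2 +
t β)` is the coefficient of `t`. -/
lemma fderiv_extChristoffel_vert_left (hU : IsOpen U) (hΓ : ContDiffOn ℝ ∞ Γ U)
    {z : E × (E →L[ℝ] ℝ)} (hz : z.1 ∈ U) (β : E →L[ℝ] ℝ) (A B : E × (E →L[ℝ] ℝ)) (c : E) :
    (fderiv ℝ (extChristoffel Γ) z (0, β) A B).2 c =
      -β (fderiv ℝ Γ z.1 A.1 B.1 c + fderiv ℝ Γ z.1 B.1 A.1 c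
        - fderiv ℝ Γ z.1 c A.1 B.1 - (2 : ℝ) • Γ z.1 (Γ z.1 A.1 B.1) c) := by
  have hd := differentiableAt_extChristoffel hU hΓ hz
  have hd' : DifferentiableAt ℝ (fun y => extChristoffel Γ y A B) z :=
    (hd.clm_apply (differentiableAt_const _)).clm_apply (differentiableAt_const _)
  rw [fderiv_clm_apply_apply hd, fderiv_snd_comp_apply hd']
  have hline : HasDerivAt (fun t : ℝ => (z.1, z.2 + t • β)) ((0 : E), β) 0 := by
    refine HasDerivAt.prodMk (hasDerivAt_const _ _) ?_
    simpa using ((hasDerivAt_id (0 : ℝ)).smul_const β).const_add z.2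
  have hf : DifferentiableAt ℝ (fun y => (extChristoffel Γ y A B).2 c) z :=
    hd'.snd.clm_apply (differentiableAt_const _)
  have h0 : (z.1, z.2 + (0 : ℝ) • β) = z := by simp
  have h1 : HasFDerivAt (fun y => (extChristoffel Γ y A B).2 c)
      (fderiv ℝ (fun y => (extChristoffel Γ y A B).2 c) z)
      ((fun t : ℝ => (z.1, z.2 + t • β)) 0) := by
    show HasFDerivAt _ _ (z.1, z.2 + (0 : ℝ) • β)
    rw [h0]; exact hf.hasFDerivAt
  have h2 := h1.comp_hasDerivAt (0 : ℝ) hline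
  set K := fderiv ℝ Γ z.1 A.1 B.1 c + fderiv ℝ Γ z.1 B.1 A.1 c
        - fderiv ℝ Γ z.1 c A.1 B.1 - (2 : ℝ) • Γ z.1 (Γ z.1 A.1 B.1) c with hK
  have h3 : ((fun y => (extChristoffel Γ y A B).2 c) ∘ fun t : ℝ => (z.1, z.2 + t • β)) =
      fun t => (- A.2 (Γ z.1 B.1 c) - B.2 (Γ z.1 A.1 c) - z.2 K) - t * β K := by
    ext t
    simp only [Function.comp_apply, extChristoffel_snd_apply, clm_add_apply, clm_smul_apply,
      smul_eq_mul]
    rw [← hK]; ring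
  rw [h3] at h2
  have h4 : HasDerivAt (fun t : ℝ =>
      (- A.2 (Γ z.1 B.1 c) - B.2 (Γ z.1 A.1 c) - z.2 K) - t * β K) (-β K) 0 := by
    simpa using ((hasDerivAt_id (0 : ℝ)).mul_const (β K)).const_sub
      (- A.2 (Γ z.1 B.1 c) - B.2 (Γ z.1 A.1 c) - z.2 K)
  exact h2.unique h4

lemma extChristoffel_vert_left (z : E × (E →L[ℝ] ℝ)) (β : E →L[ℝ] ℝ) (B : E × (E →L[ℝ] ℝ)) :
    extChristoffel Γ z (0, β) B = (0, -(β ∘L Γ z.1 B.1)) := by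
  refine Prod.ext ?_ (ContinuousLinearMap.ext fun c => ?_)
  · rw [extChristoffel_fst]; simp
  · rw [extChristoffel_snd_apply]; simp

lemma extChristoffel_vert_right (z : E × (E →L[ℝ] ℝ)) (β : E →L[ℝ] ℝ) (B : E × (E →L[ℝ] ℝ)) :
    extChristoffel Γ z B (0, β) = (0, -(β ∘L Γ z.1 B.1)) := by
  refine Prod.ext ?_ (ContinuousLinearMap.ext fun c => ?_)
  · rw [extChristoffel_fst]; simp
  · rw [extChristoffel_snd_apply]; simp

/-- With a vertical argument the symbols no longer involve the fibre variable, and only the base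
derivative of `Γ` contributes. -/
lemma fderiv_extChristoffel_vert_mid (hU : IsOpen U) (hΓ : ContDiffOn ℝ ∞ Γ U)
    {z : E × (E →L[ℝ] ℝ)} (hz : z.1 ∈ U) (β : E →L[ℝ] ℝ) (A B : E × (E →L[ℝ] ℝ)) (c : E) :
    (fderiv ℝ (extChristoffel Γ) z A (0, β) B).2 c = -β (fderiv ℝ Γ z.1 A.1 B.1 c) := by
  have hd := differentiableAt_extChristoffel hU hΓ hz
  have hd' : DifferentiableAt ℝ (fun y => extChristoffel Γ y (0, β) B) z :=
    (hd.clm_apply (differentiableAt_const _)).clm_apply (differentiableAt_const _)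
  rw [fderiv_clm_apply_apply hd, fderiv_snd_comp_apply hd']
  have h1 : (fun y => (extChristoffel Γ y (0, β) B).2 c) =
      fun y : E × (E →L[ℝ] ℝ) => (fun u => -β (Γ u B.1 c)) y.1 := by
    ext y; rw [extChristoffel_vert_left]; rfl
  have hΓd := hΓ.differentiableAt_of_isOpen hU hz
  have h2 := ((β.hasFDerivAt.comp z.1 ((hΓd.hasFDerivAt.clm_apply
    (hasFDerivAt_const B.1 z.1)).clm_apply (hasFDerivAt_const c z.1))).neg)
  have h3 : HasFDerivAt (fun u => -β (Γ u B.1 c)) _ z.1 := h2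
  rw [h1, fderiv_comp_fst h3.differentiableAt, h3.fderiv]
  simp

/-- The curvature operators `R(V, A)` with `V` vertical. -/
lemma riem_extChristoffel_vert (hU : IsOpen U) (hΓ : ContDiffOn ℝ ∞ Γ U)
    (hsymm : ∀ u ∈ U, ∀ a b, Γ u a b = Γ u b a)
    {z : E × (E →L[ℝ] ℝ)} (hz : z.1 ∈ U) (β : E →L[ℝ] ℝ) (A B : E × (E →L[ℝ] ℝ)) :
    (riem (extChristoffel Γ) z (0, β) A B).1 = 0 ∧ ∀ c,
      (riem (extChristoffel Γ) z (0, β) A B).2 c = -β (riem Γ z.1 B.1 c A.1) := by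
  constructor
  · rw [riem_extChristoffel_fst hU hΓ hz]
    simp [riem]
  · intro c
    have hΓd := hΓ.differentiableAt_of_isOpen hU hz
    have hs : ∀ a b c, fderiv ℝ Γ z.1 a b c = fderiv ℝ Γ z.1 a c b := by
      intro a b c
      rw [fderiv_clm_apply_apply hΓd, fderiv_clm_apply_apply hΓd]
      congr 1
      exact Filter.EventuallyEq.fderiv_eq (Filter.eventuallyEq_of_mem (hU.mem_nhds hz)
        fun u hu => hsymm u hu b c)
    rw [riem]
    simp only [Prod.snd_add, Prod.snd_sub, clm_add_apply, clm_sub_apply,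
      fderiv_extChristoffel_vert_left hU hΓ hz, fderiv_extChristoffel_vert_mid hU hΓ hz,
      extChristoffel_vert_left, extChristoffel_vert_right]
    simp only [extChristoffel_fst, riem, ContinuousLinearMap.comp_apply,
      neg_apply, ContinuousLinearMap.map_add, ContinuousLinearMap.map_sub,
      ContinuousLinearMap.map_smul, smul_eq_mul]
    -- The derivative of `Γ` along `A` has already been produced with both signs, and one of the two
    -- copies of `Γ(Γ(A, B), c)` is cancelled by the product term. Torsion-freeness arranges what is
    -- left into `R(B, c)A`.
    rw [hs B.1 c A.1, hs c B.1 A.1, hsymm _ hz c A.1, hsymm _ hz B.1 A.1,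
      hsymm _ hz c (Γ z.1 A.1 B.1)]
    ring

/-- Every ingredient of the Szabó operator projects to its counterpart for `Γ`; under the derivative
this uses that the curvature identity holds near `z`, not just at `z`. -/
lemma localSzabo_extChristoffel_fst (hU : IsOpen U) (hΓ : ContDiffOn ℝ ∞ Γ U)
    {z : E × (E →L[ℝ] ℝ)} (hz : z.1 ∈ U) (A B : E × (E →L[ℝ] ℝ)) :
    (localSzabo (extChristoffel Γ) z A B).1 = localSzabo Γ z.1 A.1 B.1 := by
  have hU' : IsOpen (U ×ˢ (Set.univ : Set (E →L[ℝ] ℝ))) := hU.prod isOpen_univ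
  have hd := differentiableAt_riem hU' (contDiffOn_extChristoffel hU hΓ)
    (u := z) ⟨hz, trivial⟩ B A A
  have h1 : (fderiv ℝ (fun y => riem (extChristoffel Γ) y B A A) z A).1 =
      fderiv ℝ (fun u => riem Γ u B.1 A.1 A.1) z.1 A.1 := by
    rw [fderiv_fst_comp hd, ← fderiv_comp_fst (differentiableAt_riem hU hΓ hz _ _ _)]
    congr 1
    refine Filter.EventuallyEq.fderiv_eq (Filter.eventuallyEq_of_mem
      (hU'.mem_nhds (x := z) ⟨hz, trivial⟩) fun y hy => ?_)
    exact riem_extChristoffel_fst hU hΓ hy.1 B A A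
  simp only [localSzabo, Prod.fst_add, Prod.fst_sub, h1, extChristoffel_fst,
    riem_extChristoffel_fst hU hΓ hz]

/-- Differentiating `R(V, A)B = -β(R(B, ·)A)` covariantly along `A` gives `-β((∇_A R)(A, ·)A)`, and
antisymmetry of `R` in its first two arguments turns this into `β ∘ S(A)`. So the vertical block is
the transpose of the base block. -/
lemma localSzabo_extChristoffel_vert (hU : IsOpen U) (hΓ : ContDiffOn ℝ ∞ Γ U)
    (hsymm : ∀ u ∈ U, ∀ a b, Γ u a b = Γ u b a)
    {z : E × (E →L[ℝ] ℝ)} (hz : z.1 ∈ U) (A : E × (E →L[ℝ] ℝ)) (β : E →L[ℝ] ℝ) (c : E) :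
    (localSzabo (extChristoffel Γ) z A (0, β)).2 c = β (localSzabo Γ z.1 A.1 c) := by
  have hU' : IsOpen (U ×ˢ (Set.univ : Set (E →L[ℝ] ℝ))) := hU.prod isOpen_univ
  have hd := differentiableAt_riem hU' (contDiffOn_extChristoffel hU hΓ)
    (u := z) ⟨hz, trivial⟩ (0, β) A A
  have hr : DifferentiableAt ℝ (fun u => riem Γ u A.1 c A.1) z.1 :=
    differentiableAt_riem hU hΓ hz _ _ _
  have h1 : (fderiv ℝ (fun y => riem (extChristoffel Γ) y (0, β) A A) z A).2 c =
      -β (fderiv ℝ (fun u => riem Γ u A.1 c A.1) z.1 A.1) := by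
    have h2 : HasFDerivAt (fun u => -β (riem Γ u A.1 c A.1)) _ z.1 :=
      (β.hasFDerivAt.comp z.1 hr.hasFDerivAt).neg
    have h3 : fderiv ℝ (fun u => -β (riem Γ u A.1 c A.1)) z.1 A.1 =
        -β (fderiv ℝ (fun u => riem Γ u A.1 c A.1) z.1 A.1) := by
      rw [h2.fderiv]; simp
    rw [fderiv_snd_comp_apply hd, ← h3, ← fderiv_comp_fst h2.differentiableAt]
    congr 1
    refine Filter.EventuallyEq.fderiv_eq (Filter.eventuallyEq_of_mem
      (hU'.mem_nhds (x := z) ⟨hz, trivial⟩) fun y hy => ?_)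
    exact (riem_extChristoffel_vert hU hΓ hsymm hy.1 β A A).2 c
  have hv (β' : E →L[ℝ] ℝ) (B C : E × (E →L[ℝ] ℝ)) (c : E) :
      (riem (extChristoffel Γ) z (0, β') B C).2 c = -β' (riem Γ z.1 C.1 c B.1) :=
    (riem_extChristoffel_vert hU hΓ hsymm hz β' B C).2 c
  have hv' : riem (extChristoffel Γ) z (0, β) A A =
      (0, (riem (extChristoffel Γ) z (0, β) A A).2) :=
    Prod.ext (riem_extChristoffel_vert hU hΓ hsymm hz β A A).1 rfl
  have h4 : fderiv ℝ (fun u => riem Γ u c A.1 A.1) z.1 A.1 =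
      -fderiv ℝ (fun u => riem Γ u A.1 c A.1) z.1 A.1 := by
    have : (fun u => riem Γ u c A.1 A.1) = fun u => -riem Γ u A.1 c A.1 := by
      ext u; rw [riem_swap]
    rw [this, fderiv_fun_neg]; rfl
  rw [localSzabo, hv', extChristoffel_vert_right, extChristoffel_vert_right]
  simp only [Prod.snd_add, Prod.snd_sub, clm_add_apply, clm_sub_apply, clm_neg_apply, h1, hv,
    ContinuousLinearMap.comp_apply, extChristoffel_fst]
  rw [localSzabo, h4, riem_swap z.1 c A.1 A.1, riem_swap z.1 (Γ z.1 A.1 c) A.1 A.1,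
    riem_swap z.1 c (Γ z.1 A.1 A.1), riem_swap z.1 c A.1 (Γ z.1 A.1 A.1)]
  simp only [ContinuousLinearMap.map_add, ContinuousLinearMap.map_sub, ContinuousLinearMap.map_neg]
  ring

end LocalExtension

/-! ### Linear algebra: Koszul uniqueness and characteristic polynomials. -/

section LinearAlgebra

open Polynomial

/-- A torsion-free bilinear map that is metric for a nondegenerate symmetric form is unique. -/
lemma koszul_unique {F : Type*} [AddCommGroup F] [Module ℝ F] (G : F → F → ℝ)
    (hadd : ∀ a b c, G (a - b) c = G a c - G b c) (hG : ∀ a b, G a b = G b a)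
    (hnd : ∀ a, (∀ b, G a b = 0) → a = 0) (d : F → F → F → ℝ) (Γ Γ' : F → F → F)
    (hs : ∀ a b, Γ a b = Γ b a) (hs' : ∀ a b, Γ' a b = Γ' b a)
    (hm : ∀ c a b, d c a b = G (Γ c a) b + G a (Γ c b))
    (hm' : ∀ c a b, d c a b = G (Γ' c a) b + G a (Γ' c b)) (a b : F) : Γ a b = Γ' a b := by
  rw [← sub_eq_zero]
  refine hnd _ fun c => ?_
  rw [hadd]
  -- Writing `e` for the three cyclic choices and forming `h1 + h2 - h3` leaves `2 G(Γ(a, b), c)` on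
  -- each side, the other terms cancelling by symmetry of `Γ` and `Γ'`.
  have e (c a b : F) : G (Γ c a) b + G (Γ c b) a = G (Γ' c a) b + G (Γ' c b) a := by
    rw [hG _ a, hG _ a, ← hm, ← hm']
  have h1 := e a b c
  have h2 := e b a c
  have h3 := e c a b
  rw [hs b a, hs' b a] at h2
  rw [hs c a, hs' c a, hs c b, hs' c b] at h3
  linarith

variable {E : Type*} [NormedAddCommGroup E] [NormedSpace ℝ E] [FiniteDimensional ℝ E]

/-- In a basis and its dual basis the matrix is block lower triangular with diagonal blocks the
matrix of `S` and its transpose; the off-diagonal block is arbitrary and does not matter. -/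
lemma charpoly_prod_dual (S : E →ₗ[ℝ] E) (L : E × (E →L[ℝ] ℝ) →ₗ[ℝ] E × (E →L[ℝ] ℝ))
    (h1 : ∀ w, (L w).1 = S w.1) (h2 : ∀ β c, (L (0, β)).2 c = β (S c)) :
    L.charpoly = S.charpoly ^ 2 := by
  classical
  let b := Module.finBasis ℝ E
  let b' : Module.Basis _ ℝ (E →L[ℝ] ℝ) := b.dualBasis.map LinearMap.toContinuousLinearMap
  have hb' (i j) : b' i (b j) = if j = i then 1 else 0 := by
    simp only [b', Module.Basis.map_apply, LinearMap.coe_toContinuousLinearMap',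
      Module.Basis.dualBasis_apply_self]
  have hrepr (β : E →L[ℝ] ℝ) (i) : b'.repr β i = β (b i) := by
    have h := congrArg (fun f : E →L[ℝ] ℝ => f (b i)) (b'.sum_repr β)
    rw [← h, sum_apply]
    simp only [smul_apply, hb']
    simp
  rw [← LinearMap.charpoly_toMatrix L (b.prod b'), ← LinearMap.charpoly_toMatrix S b]
  have hM : LinearMap.toMatrix (b.prod b') (b.prod b') L =
      Matrix.fromBlocks (LinearMap.toMatrix b b S) 0
        (Matrix.of fun i j => b'.repr (L (b j, 0)).2 i) (LinearMap.toMatrix b b S).transpose := by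
    ext i j
    rcases i with i | i <;> rcases j with j | j
    · simp [LinearMap.toMatrix_apply, h1]
    · simp [LinearMap.toMatrix_apply, h1]
    · simp [LinearMap.toMatrix_apply]
    · simp only [LinearMap.toMatrix_apply, Module.Basis.prod_apply, Matrix.fromBlocks_apply₂₂,
        Matrix.transpose_apply, Module.Basis.prod_repr_inr, Sum.elim_inr, Function.comp_apply,
        LinearMap.inr_apply, hrepr, h2]
      have h := congrArg (b' j) (b.sum_repr (S (b i)))
      rw [← h]
      simp only [map_sum, map_smul, hb']
      simp
  rw [hM, Matrix.charpoly_fromBlocks_zero₁₂, Matrix.charpoly_transpose, sq]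

/-- From `det(rx - rS) = rⁿ det(x - S)`, invariance of the characteristic polynomial under `S ↦ rS`
gives `χ(rx) = rⁿ χ(x)`. Comparing coefficients, `(rⁿ - rᵏ) c_k = 0`, and `rᵏ < rⁿ` for `k < n`. -/
lemma charpoly_eq_X_pow_of_smul (S : E →ₗ[ℝ] E) {r : ℝ} (hr : 1 < r)
    (h : (r • S).charpoly = S.charpoly) : S.charpoly = X ^ Module.finrank ℝ E := by
  let b := Module.finBasis ℝ E
  let A := LinearMap.toMatrix b b S
  have hA : A.charpoly = S.charpoly := LinearMap.charpoly_toMatrix S b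
  have hA' : (r • A).charpoly = S.charpoly := by
    rw [← h, ← LinearMap.charpoly_toMatrix (r • S) b, map_smul]
  have hcomp : S.charpoly.comp (C r * X) = C (r ^ Module.finrank ℝ E) * S.charpoly := by
    refine Polynomial.funext fun x => ?_
    rw [eval_comp, eval_mul, eval_mul, eval_C, eval_C, eval_X]
    conv_lhs => rw [← hA']
    rw [← hA, Matrix.eval_charpoly, Matrix.eval_charpoly]
    have : Matrix.scalar (Fin (Module.finrank ℝ E)) (r * x) - r • A =
        r • (Matrix.scalar _ x - A) := by
      ext i j
      simp [Matrix.diagonal_apply, mul_sub]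
    rw [this, Matrix.det_smul, Fintype.card_fin]
  have hdeg : S.charpoly.natDegree = Module.finrank ℝ E := S.charpoly_natDegree
  ext k
  rw [coeff_X_pow]
  rcases lt_trichotomy k (Module.finrank ℝ E) with hk | hk | hk
  · have h := congrArg (fun p => p.coeff k) hcomp
    simp only [comp_C_mul_X_coeff, coeff_C_mul] at h
    have hlt : r ^ k < r ^ Module.finrank ℝ E := pow_lt_pow_right₀ hr hk
    rw [if_neg hk.ne]
    have : (r ^ Module.finrank ℝ E - r ^ k) * S.charpoly.coeff k = 0 := by linarith
    exact (mul_eq_zero.1 this).resolve_left (sub_pos.2 hlt).ne'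
  · rw [if_pos hk, hk, ← hdeg]
    exact S.charpoly_monic
  · rw [if_neg hk.ne', coeff_eq_zero_of_natDegree_lt (hdeg ▸ hk)]

lemma _root_.Polynomial.Monic.eq_of_sq_eq_sq {p q : ℝ[X]} (hp : p.Monic) (hq : q.Monic)
    (h : p ^ 2 = q ^ 2) : p = q := by
  rcases sq_eq_sq_iff_eq_or_eq_neg.1 h with h | h
  · exact h
  · have := congrArg leadingCoeff h
    rw [leadingCoeff_neg, hp, hq] at this
    norm_num at this

end LinearAlgebra

/-! ### Vector fields and their brackets in a smooth chart. -/

section Chart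

variable {F : Type*} [NormedAddCommGroup F] [NormedSpace ℝ F]
  {H : Type*} [TopologicalSpace H] {J : ModelWithCorners ℝ F H}
  {N : Type*} [TopologicalSpace N] [ChartedSpace H N]

lemma mdifferentiableAt_vectorSpace_iff {f : F → F} {u : F} :
    MDifferentiableAt 𝓘(ℝ, F) 𝓘(ℝ, F).tangent (fun y => (⟨y, f y⟩ : TangentBundle 𝓘(ℝ, F) F)) u ↔
      DifferentiableAt ℝ f u := by
  rw [(trivializationAt F (TangentSpace 𝓘(ℝ, F)) u).mdifferentiableAt_section_iff 𝓘(ℝ, F)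
    (s := fun y => (f y : TangentSpace 𝓘(ℝ, F) y)) (FiberBundle.mem_baseSet_trivializationAt' u),
    ← mdifferentiableAt_iff_differentiableAt]
  simp [trivializationAt_model_space_apply]

lemma two_le_infty : (2 : WithTop ℕ∞) ≤ ∞ := WithTop.coe_le_coe.2 (le_top (a := (2 : ℕ∞)))

variable (J) in
/-- `φ` is a diffeomorphism of an open subset of `N` onto an open subset of the model space. -/
structure IsSmoothChart (φ : PartialEquiv N F) : Prop where
  isOpen_source : IsOpen φ.source
  isOpen_target : IsOpen φ.target
  contMDiffOn : ContMDiffOn J 𝓘(ℝ, F) ∞ φ φ.source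
  contMDiffOn_symm : ContMDiffOn 𝓘(ℝ, F) J ∞ φ.symm φ.target

lemma isSmoothChart_extChartAt [J.Boundaryless] [IsManifold J ∞ N] (x : N) :
    IsSmoothChart J (extChartAt J x) where
  isOpen_source := isOpen_extChartAt_source x
  isOpen_target := isOpen_extChartAt_target x
  contMDiffOn := by rw [extChartAt_source]; exact contMDiffOn_extChartAt
  contMDiffOn_symm := contMDiffOn_extChartAt_symm x

variable (J) in
/-- The components of the vector field `X` in the chart `φ`. -/
def coords (φ : PartialEquiv N F) (X : Π y : N, TangentSpace J y) (u : F) : F :=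
  mfderiv J 𝓘(ℝ, F) φ (φ.symm u) (X (φ.symm u))

variable (J) in
/-- The vector field with components `f` in the chart `φ`. -/
def ofCoords (φ : PartialEquiv N F) (f : F → F) (y : N) : TangentSpace J y :=
  (mfderiv J 𝓘(ℝ, F) φ y).inverse (f (φ y))

namespace IsSmoothChart

variable {φ : PartialEquiv N F} (hφ : IsSmoothChart J φ)

include hφ

lemma contMDiffAt {y : N} (hy : y ∈ φ.source) : ContMDiffAt J 𝓘(ℝ, F) ∞ φ y :=
  hφ.contMDiffOn.contMDiffAt (hφ.isOpen_source.mem_nhds hy)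

lemma contMDiffAt_symm {u : F} (hu : u ∈ φ.target) : ContMDiffAt 𝓘(ℝ, F) J ∞ φ.symm u :=
  hφ.contMDiffOn_symm.contMDiffAt (hφ.isOpen_target.mem_nhds hu)

lemma mdifferentiableAt {y : N} (hy : y ∈ φ.source) : MDifferentiableAt J 𝓘(ℝ, F) φ y :=
  (hφ.contMDiffAt hy).mdifferentiableAt (by simp)

lemma mdifferentiableAt_symm {u : F} (hu : u ∈ φ.target) :
    MDifferentiableAt 𝓘(ℝ, F) J φ.symm u :=
  (hφ.contMDiffAt_symm hu).mdifferentiableAt (by simp)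

lemma mfderiv_mfderiv_symm {u : F} (hu : u ∈ φ.target) (v : F) :
    mfderiv J 𝓘(ℝ, F) φ (φ.symm u) (mfderiv 𝓘(ℝ, F) J φ.symm u v) = v := by
  have h1 : mfderiv 𝓘(ℝ, F) 𝓘(ℝ, F) (φ ∘ φ.symm) u = mfderiv 𝓘(ℝ, F) 𝓘(ℝ, F) id u := by
    apply Filter.EventuallyEq.mfderiv_eq
    filter_upwards [hφ.isOpen_target.mem_nhds hu] with w hw using φ.right_inv hw
  rw [mfderiv_comp u (hφ.mdifferentiableAt (φ.map_target hu)) (hφ.mdifferentiableAt_symm hu),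
    mfderiv_id] at h1
  exact congrArg (fun L : F →L[ℝ] F => L v) h1

lemma mfderiv_symm_mfderiv {y : N} (hy : y ∈ φ.source) (v : TangentSpace J y) :
    mfderiv 𝓘(ℝ, F) J φ.symm (φ y) (mfderiv J 𝓘(ℝ, F) φ y v) = v := by
  have h1 : mfderiv J J (φ.symm ∘ φ) y = mfderiv J J id y := by
    apply Filter.EventuallyEq.mfderiv_eq
    filter_upwards [hφ.isOpen_source.mem_nhds hy] with w hw using φ.left_inv hw
  rw [mfderiv_comp y (hφ.mdifferentiableAt_symm (φ.map_source hy)) (hφ.mdifferentiableAt hy),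
    mfderiv_id] at h1
  exact congrArg (fun L : F →L[ℝ] F => L v) h1

/-- The derivative of a chart, as a continuous linear equivalence. -/
def derivEquiv {y : N} (hy : y ∈ φ.source) : TangentSpace J y ≃L[ℝ] F :=
  ContinuousLinearEquiv.equivOfInverse (M₂ := F) (mfderiv J 𝓘(ℝ, F) φ y)
    (mfderiv 𝓘(ℝ, F) J φ.symm (φ y) : F →L[ℝ] F) (hφ.mfderiv_symm_mfderiv hy) fun v => by
      have := hφ.mfderiv_mfderiv_symm (φ.map_source hy) v
      rwa [φ.left_inv hy] at this

lemma inverse_mfderiv {y : N} (hy : y ∈ φ.source) :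
    (mfderiv J 𝓘(ℝ, F) φ y).inverse = mfderiv 𝓘(ℝ, F) J φ.symm (φ y) :=
  ContinuousLinearMap.inverse_equiv (M₂ := F) (hφ.derivEquiv hy)

lemma isInvertible_mfderiv {y : N} (hy : y ∈ φ.source) :
    (mfderiv J 𝓘(ℝ, F) φ y).IsInvertible := ⟨hφ.derivEquiv hy, rfl⟩

lemma isInvertible_mfderiv_symm {u : F} (hu : u ∈ φ.target) :
    (mfderiv 𝓘(ℝ, F) J φ.symm u).IsInvertible :=
  ⟨ContinuousLinearEquiv.equivOfInverse (M₁ := F) (mfderiv 𝓘(ℝ, F) J φ.symm u)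
    (mfderiv J 𝓘(ℝ, F) φ (φ.symm u) : TangentSpace J (φ.symm u) →L[ℝ] F)
    (hφ.mfderiv_mfderiv_symm hu) (fun v => by
      have := hφ.mfderiv_symm_mfderiv (φ.map_target hu) v
      rwa [φ.right_inv hu] at this), rfl⟩

lemma inverse_mfderiv_symm {u : F} (hu : u ∈ φ.target) :
    (mfderiv 𝓘(ℝ, F) J φ.symm u).inverse = mfderiv J 𝓘(ℝ, F) φ (φ.symm u) :=
  ContinuousLinearMap.inverse_equiv (M := F) (ContinuousLinearEquiv.equivOfInverse (M₁ := F)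
    (mfderiv 𝓘(ℝ, F) J φ.symm u)
    (mfderiv J 𝓘(ℝ, F) φ (φ.symm u) : TangentSpace J (φ.symm u) →L[ℝ] F)
    (hφ.mfderiv_mfderiv_symm hu) (fun v => by
      have := hφ.mfderiv_symm_mfderiv (φ.map_target hu) v
      rwa [φ.right_inv hu] at this))

/-- Regarding components as a pullback gives access to the regularity of pulled-back fields and to
the naturality of the Lie bracket. -/
lemma coords_eq_mpullback (X : Π y : N, TangentSpace J y) {u : F} (hu : u ∈ φ.target) :
    coords J φ X u = VectorField.mpullback 𝓘(ℝ, F) J φ.symm X u := by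
  rw [VectorField.mpullback_apply, hφ.inverse_mfderiv_symm hu]
  rfl

lemma coords_ofCoords (f : F → F) {u : F} (hu : u ∈ φ.target) :
    coords J φ (ofCoords J φ f) u = f u := by
  rw [coords, ofCoords, hφ.inverse_mfderiv (φ.map_target hu), φ.right_inv hu]
  exact hφ.mfderiv_mfderiv_symm hu _

lemma mfderiv_ofCoords (f : F → F) {y : N} (hy : y ∈ φ.source) :
    mfderiv J 𝓘(ℝ, F) φ y (ofCoords J φ f y) = f (φ y) := by
  have := hφ.coords_ofCoords f (φ.map_source hy)
  rwa [coords, φ.left_inv hy] at this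

omit hφ in
lemma coords_apply (X : Π y : N, TangentSpace J y) {y : N} (hy : y ∈ φ.source) :
    coords J φ X (φ y) = mfderiv J 𝓘(ℝ, F) φ y (X y) := by
  rw [coords, φ.left_inv hy]

lemma ofCoords_coords (X : Π y : N, TangentSpace J y) {y : N} (hy : y ∈ φ.source) :
    ofCoords J φ (coords J φ X) y = X y := by
  rw [ofCoords, coords_apply X hy, hφ.inverse_mfderiv hy]
  exact hφ.mfderiv_symm_mfderiv hy _

lemma mvfderiv_eq {G : Type*} [NormedAddCommGroup G] [NormedSpace ℝ G] {f : N → G} {y : N}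
    (hy : y ∈ φ.source) (hf : MDifferentiableAt J 𝓘(ℝ, G) f y) (v : TangentSpace J y) :
    mvfderiv J f y v = fderiv ℝ (f ∘ φ.symm) (φ y) (mfderiv J 𝓘(ℝ, F) φ y v) := by
  rw [← φ.left_inv hy] at hf
  have h := mfderiv_comp (φ y) hf (hφ.mdifferentiableAt_symm (φ.map_source hy))
  rw [mfderiv_eq_fderiv] at h
  rw [h]
  change _ = mfderiv J 𝓘(ℝ, G) f (φ.symm (φ y)) (mfderiv 𝓘(ℝ, F) J φ.symm (φ y) _)
  rw [hφ.mfderiv_symm_mfderiv hy, φ.left_inv hy]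
  rfl

lemma mdifferentiableAt_fun_iff {G : Type*} [NormedAddCommGroup G] [NormedSpace ℝ G] {f : N → G}
    {y : N} (hy : y ∈ φ.source) :
    MDifferentiableAt J 𝓘(ℝ, G) f y ↔ DifferentiableAt ℝ (f ∘ φ.symm) (φ y) := by
  rw [← mdifferentiableAt_iff_differentiableAt]
  constructor
  · intro h
    rw [← φ.left_inv hy] at h
    exact h.comp (φ y) (hφ.mdifferentiableAt_symm (φ.map_source hy))
  · intro h
    refine (h.comp y (hφ.mdifferentiableAt hy)).congr_of_eventuallyEq ?_
    filter_upwards [hφ.isOpen_source.mem_nhds hy] with w hw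
    simp [φ.left_inv hw]

variable [IsManifold J ∞ N] [CompleteSpace F]

lemma mdifferentiableAt_iff (X : Π y : N, TangentSpace J y) {y : N} (hy : y ∈ φ.source) :
    MDifferentiableAt J J.tangent (fun y => (⟨y, X y⟩ : TangentBundle J N)) y ↔
      DifferentiableAt ℝ (coords J φ X) (φ y) := by
  have : IsManifold J 2 N := .of_le two_le_infty
  rw [← mdifferentiableAt_vectorSpace_iff]
  constructor
  · intro h
    rw [← φ.left_inv hy] at h
    refine (h.mpullback_vectorField (hφ.contMDiffAt_symm (φ.map_source hy))
      (hφ.isInvertible_mfderiv_symm (φ.map_source hy)) two_le_infty).congr_of_eventuallyEq ?_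
    filter_upwards [hφ.isOpen_target.mem_nhds (φ.map_source hy)] with u hu
    rw [hφ.coords_eq_mpullback X hu]
  · intro h
    refine (h.mpullback_vectorField (V := coords J φ X) (hφ.contMDiffAt hy)
      (hφ.isInvertible_mfderiv hy) two_le_infty).congr_of_eventuallyEq ?_
    filter_upwards [hφ.isOpen_source.mem_nhds hy] with u hu
    rw [← hφ.ofCoords_coords X hu]
    rfl

lemma contDiffAt_coords {X : Π y : N, TangentSpace J y} {y : N} (hy : y ∈ φ.source)
    (h : ContMDiffAt J J.tangent ∞ (fun y => (⟨y, X y⟩ : TangentBundle J N)) y) :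
    ContDiffAt ℝ ∞ (coords J φ X) (φ y) := by
  rw [← φ.left_inv hy] at h
  refine contMDiffAt_vectorSpace_iff_contDiffAt.1
    ((h.mpullback_vectorField_preimage (n := ∞) (hφ.contMDiffAt_symm (φ.map_source hy))
    (hφ.isInvertible_mfderiv_symm (φ.map_source hy)) (by simp)).congr_of_eventuallyEq ?_)
  filter_upwards [hφ.isOpen_target.mem_nhds (φ.map_source hy)] with u hu
  rw [hφ.coords_eq_mpullback X hu]

lemma contMDiffAt_ofCoords {f : F → F} {y : N} (hy : y ∈ φ.source)
    (h : ContDiffAt ℝ ∞ f (φ y)) :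
    ContMDiffAt J J.tangent ∞ (fun y => (⟨y, ofCoords J φ f y⟩ : TangentBundle J N)) y :=
  (contMDiffAt_vectorSpace_iff_contDiffAt.2 h).mpullback_vectorField_preimage (n := ∞)
    (hφ.contMDiffAt hy)
    (hφ.isInvertible_mfderiv hy) (by simp)

lemma coords_mlieBracket {X Y : Π y : N, TangentSpace J y} {u : F} (hu : u ∈ φ.target)
    (hX : DifferentiableAt ℝ (coords J φ X) u) (hY : DifferentiableAt ℝ (coords J φ Y) u) :
    coords J φ (VectorField.mlieBracket J X Y) u =
      VectorField.lieBracket ℝ (coords J φ X) (coords J φ Y) u := by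
  have : IsManifold J (minSmoothness ℝ 2) N := .of_le (n := ∞)
    (by simpa using two_le_infty)
  rw [← φ.right_inv hu, ← hφ.mdifferentiableAt_iff _ (φ.map_target hu)] at hX hY
  have e (X) : coords J φ X =ᶠ[nhds u] VectorField.mpullback 𝓘(ℝ, F) J φ.symm X := by
    filter_upwards [hφ.isOpen_target.mem_nhds hu] with w hw using hφ.coords_eq_mpullback X hw
  rw [hφ.coords_eq_mpullback _ hu, VectorField.mpullback_mlieBracket hX hY
    (hφ.contMDiffAt_symm hu) (by simpa using two_le_infty), ← VectorField.mlieBracketWithin_univ,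
    VectorField.mlieBracketWithin_eq_lieBracketWithin]
  exact (congrFun VectorField.lieBracketWithin_univ u).trans
    ((e X).lieBracket_vectorField_eq (e Y)).symm

end IsSmoothChart

end Chart

/-! ### Existence and symmetry of Christoffel symbols in a chart. -/

section Christoffel

variable {F : Type*} [NormedAddCommGroup F] [NormedSpace ℝ F]
  {H : Type*} [TopologicalSpace H] {J : ModelWithCorners ℝ F H}
  {N : Type*} [TopologicalSpace N] [ChartedSpace H N]

variable (J) in
/-- The derivative of the chart `φ` at `y`. -/
def dchart (φ : PartialEquiv N F) (y : N) : TangentSpace J y →L[ℝ] F :=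
  mfderiv J 𝓘(ℝ, F) φ y

variable (J) in
/-- The derivative of the inverse of the chart `φ` at `u`. -/
def dchartSymm (φ : PartialEquiv N F) (u : F) : F →L[ℝ] TangentSpace J (φ.symm u) :=
  mfderiv 𝓘(ℝ, F) J φ.symm u

lemma coords_add (φ : PartialEquiv N F) (X Y : Π y : N, TangentSpace J y) :
    coords J φ (X + Y) = coords J φ X + coords J φ Y :=
  funext fun u => ContinuousLinearMap.map_add (mfderiv J 𝓘(ℝ, F) φ (φ.symm u)) _ _

lemma coords_smul (φ : PartialEquiv N F) (f : N → ℝ) (X : Π y : N, TangentSpace J y) (u : F) :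
    coords J φ (f • X) u = f (φ.symm u) • coords J φ X u :=
  ContinuousLinearMap.map_smul (mfderiv J 𝓘(ℝ, F) φ (φ.symm u)) _ _

lemma ofCoords_add (φ : PartialEquiv N F) (f g : F → F) :
    ofCoords J φ (f + g) = ofCoords J φ f + ofCoords J φ g :=
  funext fun y => ContinuousLinearMap.map_add (mfderiv J 𝓘(ℝ, F) φ y).inverse _ _

lemma ofCoords_smul (φ : PartialEquiv N F) (r : ℝ) (f : F → F) :
    ofCoords J φ (r • f) = r • ofCoords J φ f :=
  funext fun y => ContinuousLinearMap.map_smul (mfderiv J 𝓘(ℝ, F) φ y).inverse _ _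

variable {φ : PartialEquiv N F}

variable [IsManifold J ∞ N] in
/-- `Γ` are the Christoffel symbols of the connection `D` in the chart `φ`. -/
def HasChristoffel (D : CovariantDerivative J F (TangentSpace J : N → Type _))
    (φ : PartialEquiv N F) (Γ : F → F →L[ℝ] F →L[ℝ] F) : Prop :=
  ∀ (Y : Π y : N, TangentSpace J y) (y : N), y ∈ φ.source →
    MDifferentiableAt J J.tangent (fun y => (⟨y, Y y⟩ : TangentBundle J N)) y →
    ∀ v : TangentSpace J y, dchart J φ y (D Y y v) =
      fderiv ℝ (coords J φ Y) (φ y) (dchart J φ y v) + Γ (φ y) (dchart J φ y v) (dchart J φ y (Y y))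

namespace IsSmoothChart

variable (hφ : IsSmoothChart J φ)
include hφ

lemma dchart_dchartSymm {u : F} (hu : u ∈ φ.target) (v : F) :
    dchart J φ (φ.symm u) (dchartSymm J φ u v) = v := hφ.mfderiv_mfderiv_symm hu v

lemma dchartSymm_dchart {u : F} (hu : u ∈ φ.target) (v : TangentSpace J (φ.symm u)) :
    dchartSymm J φ u (dchart J φ (φ.symm u) v) = v := by
  have := hφ.mfderiv_symm_mfderiv (φ.map_target hu) v
  rwa [φ.right_inv hu] at this

lemma dchart_clm_dchartSymm (T : Π y : N, TangentSpace J y →L[ℝ] TangentSpace J y) {y : N}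
    (hy : y ∈ φ.source) (v : TangentSpace J y) :
    dchart J φ (φ.symm (φ y)) (T _ (dchartSymm J φ (φ y) (dchart J φ y v))) =
      dchart J φ y (T y v) := by
  obtain ⟨u, hu, rfl⟩ : ∃ u ∈ φ.target, φ.symm u = y := ⟨φ y, φ.map_source hy, φ.left_inv hy⟩
  rw [φ.right_inv hu, hφ.dchartSymm_dchart hu]

lemma dchart_injective {y : N} (hy : y ∈ φ.source) : Function.Injective (dchart J φ y) :=
  (hφ.derivEquiv hy).injective

lemma dchart_surjective {y : N} (hy : y ∈ φ.source) : Function.Surjective (dchart J φ y) :=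
  (hφ.derivEquiv hy).surjective

lemma coords_ofCoords_eventuallyEq (f : F → F) {u : F} (hu : u ∈ φ.target) :
    coords J φ (ofCoords J φ f) =ᶠ[nhds u] f := by
  filter_upwards [hφ.isOpen_target.mem_nhds hu] with w hw using hφ.coords_ofCoords f hw

lemma dchart_ofCoords (f : F → F) {y : N} (hy : y ∈ φ.source) :
    dchart J φ y (ofCoords J φ f y) = f (φ y) := hφ.mfderiv_ofCoords f hy

variable [IsManifold J ∞ N]

variable [CompleteSpace F]

lemma mdifferentiableAt_ofCoords {f : F → F} {y : N} (hy : y ∈ φ.source)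
    (hf : DifferentiableAt ℝ f (φ y)) :
    MDifferentiableAt J J.tangent (fun y => (⟨y, ofCoords J φ f y⟩ : TangentBundle J N)) y := by
  rw [hφ.mdifferentiableAt_iff _ hy]
  exact hf.congr_of_eventuallyEq (hφ.coords_ofCoords_eventuallyEq f (φ.map_source hy))

lemma fderiv_coords_smul {y : N} (hy : y ∈ φ.source) {f : N → ℝ} {Y : Π y : N, TangentSpace J y}
    (hf : MDifferentiableAt J 𝓘(ℝ, ℝ) f y)
    (hY : MDifferentiableAt J J.tangent (fun y => (⟨y, Y y⟩ : TangentBundle J N)) y)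
    (v : TangentSpace J y) :
    fderiv ℝ (coords J φ (f • Y)) (φ y) (dchart J φ y v) =
      f y • fderiv ℝ (coords J φ Y) (φ y) (dchart J φ y v) +
        mvfderiv J f y v • dchart J φ y (Y y) := by
  have h6 : mvfderiv J f y v = fderiv ℝ (f ∘ φ.symm) (φ y) (dchart J φ y v) :=
    hφ.mvfderiv_eq hy hf v
  have h7 : coords J φ Y (φ y) = dchart J φ y (Y y) := coords_apply Y hy
  have h3 : coords J φ (f • Y) = fun u => (f ∘ φ.symm) u • coords J φ Y u :=
    funext fun u => coords_smul φ f Y u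
  rw [h3, fderiv_fun_smul ((hφ.mdifferentiableAt_fun_iff hy).1 hf)
    ((hφ.mdifferentiableAt_iff Y hy).1 hY), Function.comp_apply, φ.left_inv hy, h6, ← h7]
  rfl

variable (D : CovariantDerivative J F (TangentSpace J : N → Type _))

/-- The connection and the flat derivative in the chart satisfy the same Leibniz rule, so the
inhomogeneous term drops out of their difference. -/
lemma tensorialAt_sub_fderiv {y : N} (hy : y ∈ φ.source) (v : TangentSpace J y) :
    TensorialAt J F (fun Y : Π y : N, TangentSpace J y =>
      dchart J φ y (D Y y v) -
        fderiv ℝ (coords J φ Y) (φ y) (dchart J φ y v)) y where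
  smul {f Y} hf hY := by
    have h1 := D.isCovariantDerivativeOnUniv.leibniz hY hf
    have h4 : D (f • Y) y v = f y • D Y y v + mvfderiv J f y v • Y y :=
      congrArg (fun L : TangentSpace J y →L[ℝ] TangentSpace J y => L v) h1
    have h5 : dchart J φ y (f y • D Y y v + mvfderiv J f y v • Y y) =
        f y • dchart J φ y (D Y y v) + mvfderiv J f y v • dchart J φ y (Y y) := by
      rw [ContinuousLinearMap.map_add, ContinuousLinearMap.map_smul, ContinuousLinearMap.map_smul]
    rw [hφ.fderiv_coords_smul hy hf hY, h4, h5]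
    module
  add {Y Z} hY hZ := by
    have h1 : D (Y + Z) y v = D Y y v + D Z y v :=
      congrArg (fun L : TangentSpace J y →L[ℝ] TangentSpace J y => L v)
        (D.isCovariantDerivativeOnUniv.add hY hZ)
    rw [coords_add, fderiv_add ((hφ.mdifferentiableAt_iff Y hy).1 hY)
      ((hφ.mdifferentiableAt_iff Z hy).1 hZ), h1, ContinuousLinearMap.map_add]
    simp only [clm_add_apply]
    abel

variable [FiniteDimensional ℝ F]

/-- The symbols are defined by applying `D` to fields with constant components. By tensoriality of
the difference from the flat derivative, an arbitrary field may be replaced by the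
constant-component field with the same value at the point. No regularity of `D` is involved, so an
arbitrary Levi-Civita connection is covered. -/
lemma exists_hasChristoffel : ∃ Γ, HasChristoffel D φ Γ := by
  have key (u : F) (hu : u ∈ φ.target) : ∃ B : F →L[ℝ] F →L[ℝ] F, ∀ a b,
      B a b = dchart J φ (φ.symm u) (D (ofCoords J φ fun _ => b) (φ.symm u)
        (dchartSymm J φ u a)) := by
    have hd (b : F) := hφ.mdifferentiableAt_ofCoords (f := fun _ => b) (φ.map_target hu)
      (differentiableAt_const b)
    let T (b : F) : F →L[ℝ] F := (dchart J φ (φ.symm u)).comp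
      ((D (ofCoords J φ fun _ => b) (φ.symm u)).comp (dchartSymm J φ u))
    let L : F →ₗ[ℝ] F →L[ℝ] F :=
      { toFun := T
        map_add' := fun b b' => by
          have h := D.isCovariantDerivativeOnUniv.add (hd b) (hd b')
          rw [← ofCoords_add] at h
          change (dchart J φ _).comp ((D (ofCoords J φ ((fun _ => b) + fun _ => b')) _).comp _) = _
          rw [h, ContinuousLinearMap.add_comp, ContinuousLinearMap.comp_add]
        map_smul' := fun r b => by
          have h := D.isCovariantDerivativeOnUniv.smul_const r (hd b)
          rw [← ofCoords_smul] at h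
          change (dchart J φ _).comp ((D (ofCoords J φ (r • fun _ => b)) _).comp _) = _
          rw [h, ContinuousLinearMap.smul_comp, ContinuousLinearMap.comp_smul]
          rfl }
    exact ⟨(LinearMap.toContinuousLinearMap L).flip, fun a b => rfl⟩
  choose! Γ hΓ using key
  refine ⟨Γ, fun Y y hy hY v => ?_⟩
  have e1 := hΓ _ (φ.map_source hy) (dchart J φ y v) (dchart J φ y (Y y))
  have e := (hφ.tensorialAt_sub_fderiv D hy v).pointwise hY
    (hφ.mdifferentiableAt_ofCoords (f := fun _ => dchart J φ y (Y y)) hy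
      (differentiableAt_const _))
    (hφ.dchart_injective hy (hφ.dchart_ofCoords (fun _ => dchart J φ y (Y y)) hy).symm)
  simp only [(hφ.coords_ofCoords_eventuallyEq _ (φ.map_source hy)).fderiv_eq] at e
  rw [sub_eq_iff_eq_add] at e
  rw [hφ.dchart_clm_dchartSymm _ hy] at e1
  rw [e, e1, fderiv_fun_const, add_comm]
  simp

end IsSmoothChart

variable [IsManifold J ∞ N] [FiniteDimensional ℝ F] [CompleteSpace F]

variable {D : CovariantDerivative J F (TangentSpace J : N → Type _)}
  {Γ : F → F →L[ℝ] F →L[ℝ] F}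

omit [FiniteDimensional ℝ F] in
lemma HasChristoffel.coords_nabla (h : HasChristoffel D φ Γ) (hφ : IsSmoothChart J φ)
    (X Y : Π y : N, TangentSpace J y) {u : F} (hu : u ∈ φ.target)
    (hY : DifferentiableAt ℝ (coords J φ Y) u) :
    coords J φ (nabla D X Y) u = localNabla Γ (coords J φ X) (coords J φ Y) u := by
  rw [← φ.right_inv hu, ← hφ.mdifferentiableAt_iff _ (φ.map_target hu)] at hY
  have := h Y (φ.symm u) (φ.map_target hu) hY (X (φ.symm u))
  rw [φ.right_inv hu] at this
  exact this

/-- Two fields with constant components commute, so vanishing torsion on them is exactly the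
symmetry of `Γ`. -/
lemma HasChristoffel.symm (h : HasChristoffel D φ Γ) (hφ : IsSmoothChart J φ)
    (hD : D.torsion = 0) {u : F} (hu : u ∈ φ.target) (a b : F) :
    Γ u a b = Γ u b a := by
  have hd (b : F) := hφ.mdifferentiableAt_ofCoords (f := fun _ => b) (φ.map_target hu)
    (differentiableAt_const b)
  have e (b : F) : DifferentiableAt ℝ (coords J φ (ofCoords J φ fun _ => b)) u :=
    (differentiableAt_const b).congr_of_eventuallyEq (hφ.coords_ofCoords_eventuallyEq _ hu)
  have h1 := (CovariantDerivative.torsion_eq_zero_iff D).1 hD (hd a) (hd b)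
  have h2 := congrArg (dchart J φ (φ.symm u)) h1
  rw [ContinuousLinearMap.map_sub] at h2
  change coords J φ (nabla D _ _) u - coords J φ (nabla D _ _) u =
    coords J φ (VectorField.mlieBracket J _ _) u at h2
  rw [h.coords_nabla hφ _ _ hu (e b), h.coords_nabla hφ _ _ hu (e a),
    hφ.coords_mlieBracket hu (e a) (e b)] at h2
  simpa [localNabla, VectorField.lieBracket, hφ.coords_ofCoords _ hu, sub_eq_zero,
    (hφ.coords_ofCoords_eventuallyEq _ hu).fderiv_eq] using h2

end Christoffel

/-! ### The Szabó operator computed in coordinates. -/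

section Rep

variable {F : Type*} [NormedAddCommGroup F] [NormedSpace ℝ F]
  {H : Type*} [TopologicalSpace H] {J : ModelWithCorners ℝ F H}
  {N : Type*} [TopologicalSpace N] [ChartedSpace H N]

variable (J) in
/-- The vector field `X` has the smooth components `f` in the chart `φ`. -/
def HasRep (φ : PartialEquiv N F) (X : Π y : N, TangentSpace J y) (f : F → F) : Prop :=
  ContDiffOn ℝ ∞ f φ.target ∧ ∀ u ∈ φ.target, coords J φ X u = f u

namespace HasRep

variable {φ : PartialEquiv N F} {X Y Z W : Π y : N, TangentSpace J y} {f g h k : F → F}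

lemma sub (hX : HasRep J φ X f) (hY : HasRep J φ Y g) : HasRep J φ (X - Y) (f - g) := by
  refine ⟨hX.1.sub hY.1, fun u hu => ?_⟩
  rw [Pi.sub_apply, ← hX.2 u hu, ← hY.2 u hu]
  exact ContinuousLinearMap.map_sub (mfderiv J 𝓘(ℝ, F) φ (φ.symm u)) _ _

lemma eventuallyEq (hφ : IsSmoothChart J φ) (hX : HasRep J φ X f) {u : F} (hu : u ∈ φ.target) :
    coords J φ X =ᶠ[nhds u] f := by
  filter_upwards [hφ.isOpen_target.mem_nhds hu] with w hw using hX.2 w hw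

lemma differentiableAt (hφ : IsSmoothChart J φ) (hX : HasRep J φ X f) {u : F}
    (hu : u ∈ φ.target) : DifferentiableAt ℝ (coords J φ X) u :=
  (hX.1.differentiableAt_of_isOpen hφ.isOpen_target hu).congr_of_eventuallyEq
    (hX.eventuallyEq hφ hu)

variable [IsManifold J ∞ N] [CompleteSpace F]
  {D : CovariantDerivative J F (TangentSpace J : N → Type _)} {Γ : F → F →L[ℝ] F →L[ℝ] F}

lemma mlieBracket (hφ : IsSmoothChart J φ) (hX : HasRep J φ X f) (hY : HasRep J φ Y g) :
    HasRep J φ (VectorField.mlieBracket J X Y) (VectorField.lieBracket ℝ f g) := by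
  refine ⟨contDiffOn_lieBracket hφ.isOpen_target hX.1 hY.1, fun u hu => ?_⟩
  rw [hφ.coords_mlieBracket hu (hX.differentiableAt hφ hu) (hY.differentiableAt hφ hu)]
  exact (hX.eventuallyEq hφ hu).lieBracket_vectorField_eq (hY.eventuallyEq hφ hu)

lemma nabla (hφ : IsSmoothChart J φ) (hD : HasChristoffel D φ Γ) (hΓ : ContDiffOn ℝ ∞ Γ φ.target)
    (hX : HasRep J φ X f) (hY : HasRep J φ Y g) :
    HasRep J φ (nabla D X Y) (localNabla Γ f g) := by
  refine ⟨contDiffOn_localNabla hφ.isOpen_target hΓ hX.1 hY.1, fun u hu => ?_⟩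
  rw [hD.coords_nabla hφ X Y hu (hY.differentiableAt hφ hu), localNabla, localNabla,
    (hY.eventuallyEq hφ hu).fderiv_eq, hX.2 u hu, hY.2 u hu]

lemma curvature (hφ : IsSmoothChart J φ) (hD : HasChristoffel D φ Γ)
    (hΓ : ContDiffOn ℝ ∞ Γ φ.target)
    (hX : HasRep J φ X f) (hY : HasRep J φ Y g) (hZ : HasRep J φ Z h) :
    HasRep J φ (curvature D X Y Z) (localCurvature Γ f g h) :=
  ((hX.nabla hφ hD hΓ (hY.nabla hφ hD hΓ hZ)).sub (hY.nabla hφ hD hΓ (hX.nabla hφ hD hΓ hZ))).sub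
    ((hX.mlieBracket hφ hY).nabla hφ hD hΓ hZ)

lemma nablaCurvature (hφ : IsSmoothChart J φ) (hD : HasChristoffel D φ Γ)
    (hΓ : ContDiffOn ℝ ∞ Γ φ.target) (hX : HasRep J φ X f) (hY : HasRep J φ Y g)
    (hZ : HasRep J φ Z h) (hW : HasRep J φ W k) :
    HasRep J φ (nablaCurvature D X Y Z W)
      (localNabla Γ f (localCurvature Γ g h k) - localCurvature Γ (localNabla Γ f g) h k
        - localCurvature Γ g (localNabla Γ f h) k - localCurvature Γ g h (localNabla Γ f k)) :=
  (((hX.nabla hφ hD hΓ (hY.curvature hφ hD hΓ hZ hW)).sub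
    ((hX.nabla hφ hD hΓ hY).curvature hφ hD hΓ hZ hW)).sub
    (hY.curvature hφ hD hΓ (hX.nabla hφ hD hΓ hZ) hW)).sub
    (hY.curvature hφ hD hΓ hZ (hX.nabla hφ hD hΓ hW))

end HasRep

variable [IsManifold J ∞ N]

/-- The canonical local extension is constant in the preferred trivialization of the tangent bundle,
and that trivialization is the derivative of the preferred chart. The extension thus has constant
components on the whole chart domain. -/
lemma hasRep_extend [J.Boundaryless] (x : N) (v : TangentSpace J x) :
    HasRep J (extChartAt J x) (FiberBundle.extend F v)
      (fun _ => dchart J (extChartAt J x) x v) := by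
  refine ⟨contDiffOn_const, fun u hu => ?_⟩
  have hy : (extChartAt J x).symm u ∈ (chartAt H x).source := by
    simpa using (extChartAt J x).map_target hu
  have hy' : (extChartAt J x).symm u ∈ (trivializationAt F (TangentSpace J) x).baseSet := by
    simpa using hy
  have hx : x ∈ (trivializationAt F (TangentSpace J) x).baseSet :=
    FiberBundle.mem_baseSet_trivializationAt' x
  rw [coords, ← TangentBundle.continuousLinearMapAt_trivializationAt hy, dchart,
    ← TangentBundle.continuousLinearMapAt_trivializationAt (mem_chart_source H x)]
  rw [FiberBundle.extend, ← Trivialization.symmL_apply (R := ℝ) _ hy']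
  refine (Trivialization.continuousLinearMapAt_symmL _ hy' _).trans ?_
  rw [Trivialization.continuousLinearMapAt_apply, Trivialization.linearMapAt_apply, if_pos hx]

variable [FiniteDimensional ℝ F] [CompleteSpace F] [J.Boundaryless]
  {D : CovariantDerivative J F (TangentSpace J : N → Type _)} {Γ : F → F →L[ℝ] F →L[ℝ] F}

lemma dchart_szaboOperator (x : N) (hD : HasChristoffel D (extChartAt J x) Γ)
    (hΓ : ContDiffOn ℝ ∞ Γ (extChartAt J x).target) (v w : TangentSpace J x) :
    dchart J (extChartAt J x) x (szaboOperator D x v w) =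
      localSzabo Γ (extChartAt J x x) (dchart J (extChartAt J x) x v)
        (dchart J (extChartAt J x) x w) := by
  have hφ := isSmoothChart_extChartAt (J := J) x
  have hx : extChartAt J x x ∈ (extChartAt J x).target := mem_extChartAt_target x
  suffices h : (dchart J (extChartAt J x) x).toLinearMap ∘ₗ szaboOperator D x v =
      localSzaboLin hφ.isOpen_target hΓ hx (dchart J (extChartAt J x) x v) ∘ₗ
        (dchart J (extChartAt J x) x).toLinearMap from
    congrArg (fun L : TangentSpace J x →ₗ[ℝ] F => L w) h
  refine (Module.finBasis ℝ (TangentSpace J x)).ext fun m => ?_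
  rw [LinearMap.comp_apply, LinearMap.comp_apply, szaboOperator, Module.Basis.constr_basis,
    localSzaboLin_apply]
  have hv := hasRep_extend (J := J) x v
  have hw := hasRep_extend (J := J) x (Module.finBasis ℝ (TangentSpace J x) m)
  have h := (hv.nablaCurvature hφ hD hΓ hw hv hv).2 _ hx
  rw [IsSmoothChart.coords_apply _ (mem_extChartAt_source x)] at h
  refine h.trans ?_
  exact localSzabo_eq hφ.isOpen_target hΓ hx _ _ _ _ rfl rfl

/-- The derivative of the chart conjugates the Szabó operator into its coordinate form, and
conjugation preserves the characteristic polynomial. -/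
lemma charpoly_szaboOperator (x : N) (hD : HasChristoffel D (extChartAt J x) Γ)
    (hΓ : ContDiffOn ℝ ∞ Γ (extChartAt J x).target) (v : TangentSpace J x) :
    (szaboOperator D x v).charpoly =
      (localSzaboLin (isOpen_extChartAt_target x) hΓ (mem_extChartAt_target x)
        (dchart J (extChartAt J x) x v)).charpoly := by
  have hφ := isSmoothChart_extChartAt (J := J) x
  let e : TangentSpace J x ≃ₗ[ℝ] F := (hφ.derivEquiv (mem_extChartAt_source x)).toLinearEquiv
  rw [← LinearEquiv.charpoly_conj e]
  congr 1
  ext w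
  have := dchart_szaboOperator x hD hΓ v (e.symm w)
  rw [LinearEquiv.conj_apply_apply, localSzaboLin_apply]
  refine this.trans ?_
  congr 1
  exact e.apply_symm_apply w

end Rep

/-! ### Levi-Civita connections: determination and construction. -/

section LeviCivita

variable {F : Type*} [NormedAddCommGroup F] [NormedSpace ℝ F]
  {H : Type*} [TopologicalSpace H] {J : ModelWithCorners ℝ F H}
  {N : Type*} [TopologicalSpace N] [ChartedSpace H N] [IsManifold J ∞ N]

/-- In the chart `φ` the metric `g` has the components `G`. -/
def PseudoRiemannianMetric.HasComponents (g : PseudoRiemannianMetric J N) (φ : PartialEquiv N F)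
    (G : F → F →L[ℝ] F →L[ℝ] ℝ) : Prop :=
  ∀ y ∈ φ.source, ∀ v w : TangentSpace J y,
    g.val y v w = G (φ y) (dchart J φ y v) (dchart J φ y w)

variable {g : PseudoRiemannianMetric J N} {φ : PartialEquiv N F} {G : F → F →L[ℝ] F →L[ℝ] ℝ}

namespace PseudoRiemannianMetric.HasComponents

lemma symm (hG : g.HasComponents φ G) (hφ : IsSmoothChart J φ) {u : F} (hu : u ∈ φ.target)
    (a b : F) : G u a b = G u b a := by
  have h (a b : F) := hG _ (φ.map_target hu) (dchartSymm J φ u a) (dchartSymm J φ u b)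
  simp only [hφ.dchart_dchartSymm hu, φ.right_inv hu] at h
  rw [← h a b, ← h b a, g.symm]

lemma nondegenerate (hG : g.HasComponents φ G) (hφ : IsSmoothChart J φ) {u : F}
    (hu : u ∈ φ.target) (a : F) (ha : ∀ b, G u a b = 0) : a = 0 := by
  have h := g.nondegenerate _ (dchartSymm J φ u a) fun w => by
    rw [hG _ (φ.map_target hu), hφ.dchart_dchartSymm hu, φ.right_inv hu, ha]
  rw [← hφ.dchart_dchartSymm hu a, h, ContinuousLinearMap.map_zero]

variable [CompleteSpace F]

lemma mvfderiv_eq (hG : g.HasComponents φ G) (hφ : IsSmoothChart J φ) {y : N} (hy : y ∈ φ.source)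
    (hd : DifferentiableAt ℝ G (φ y)) {Y Z : Π y : N, TangentSpace J y}
    (hY : MDifferentiableAt J J.tangent (fun y => (⟨y, Y y⟩ : TangentBundle J N)) y)
    (hZ : MDifferentiableAt J J.tangent (fun y => (⟨y, Z y⟩ : TangentBundle J N)) y)
    (u : TangentSpace J y) :
    mvfderiv J (fun y => g.val y (Y y) (Z y)) y u =
      fderiv ℝ G (φ y) (dchart J φ y u) (dchart J φ y (Y y)) (dchart J φ y (Z y)) +
      G (φ y) (fderiv ℝ (coords J φ Y) (φ y) (dchart J φ y u)) (dchart J φ y (Z y)) +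
      G (φ y) (dchart J φ y (Y y)) (fderiv ℝ (coords J φ Z) (φ y) (dchart J φ y u)) := by
  rw [hφ.mdifferentiableAt_iff _ hy] at hY hZ
  have h := (hd.hasFDerivAt.clm_apply hY.hasFDerivAt).clm_apply hZ.hasFDerivAt
  have e : (fun y => g.val y (Y y) (Z y)) ∘ φ.symm =ᶠ[nhds (φ y)]
      fun w => G w (coords J φ Y w) (coords J φ Z w) := by
    filter_upwards [hφ.isOpen_target.mem_nhds (φ.map_source hy)] with w hw
    rw [Function.comp_apply, hG _ (φ.map_target hw), φ.right_inv hw]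
    rfl
  have hf : MDifferentiableAt J 𝓘(ℝ, ℝ) (fun y => g.val y (Y y) (Z y)) y := by
    rw [hφ.mdifferentiableAt_fun_iff hy]
    exact h.differentiableAt.congr_of_eventuallyEq e
  have h1 : mvfderiv J (fun y => g.val y (Y y) (Z y)) y u = _ := hφ.mvfderiv_eq hy hf u
  rw [h1, e.fderiv_eq, h.fderiv]
  have hY' : coords J φ Y (φ y) = dchart J φ y (Y y) := IsSmoothChart.coords_apply Y hy
  have hZ' : coords J φ Z (φ y) = dchart J φ y (Z y) := IsSmoothChart.coords_apply Z hy
  change G (φ y) (coords J φ Y (φ y)) (fderiv ℝ (coords J φ Z) (φ y) (dchart J φ y u)) +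
    (G (φ y) (fderiv ℝ (coords J φ Y) (φ y) (dchart J φ y u)) (coords J φ Z (φ y)) +
      fderiv ℝ G (φ y) (dchart J φ y u) (coords J φ Y (φ y)) (coords J φ Z (φ y))) = _
  rw [hY', hZ']
  ring

end PseudoRiemannianMetric.HasComponents

variable [FiniteDimensional ℝ F] [CompleteSpace F]
  {D : CovariantDerivative J F (TangentSpace J : N → Type _)} {Γ : F → F →L[ℝ] F →L[ℝ] F}

/-- The unknown symbols of `D` and the proposed `Γ` are both torsion-free and metric for the same
form, so `koszul_unique` identifies them. -/
lemma PseudoRiemannianMetric.IsLeviCivita.hasChristoffel (hD : g.IsLeviCivita D)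
    (hφ : IsSmoothChart J φ) (hG : g.HasComponents φ G)
    (hd : ∀ u ∈ φ.target, DifferentiableAt ℝ G u)
    (hs : ∀ u ∈ φ.target, ∀ a b, Γ u a b = Γ u b a)
    (hm : ∀ u ∈ φ.target, ∀ c a b, fderiv ℝ G u c a b = G u (Γ u c a) b + G u a (Γ u c b)) :
    HasChristoffel D φ Γ := by
  obtain ⟨Γ', hΓ'⟩ := hφ.exists_hasChristoffel D
  have key (u) (hu : u ∈ φ.target) (a b : F) : Γ' u a b = Γ u a b := by
    refine koszul_unique (fun a b => G u a b)
      (fun a b c => by simp only [ContinuousLinearMap.map_sub, clm_sub_apply]) (hG.symm hφ hu)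
      (hG.nondegenerate hφ hu) (fun c a b => fderiv ℝ G u c a b) (fun a b => Γ' u a b)
      (fun a b => Γ u a b) (hΓ'.symm hφ hD.1 hu) (hs u hu) (fun c a b => ?_) (hm u hu) a b
    obtain ⟨y, hy, rfl⟩ : ∃ y ∈ φ.source, φ y = u :=
      ⟨φ.symm u, φ.map_target hu, φ.right_inv hu⟩
    -- On fields with constant components the metric condition becomes the algebraic identity
    -- relating the derivative of `G` to the symbols.
    have hdf (b : F) := hφ.mdifferentiableAt_ofCoords (f := fun _ => b) hy
      (differentiableAt_const b)
    obtain ⟨v, rfl⟩ := hφ.dchart_surjective hy c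
    have h := hD.2 y v _ _ (hdf a) (hdf b)
    rw [hG.mvfderiv_eq hφ hy (hd _ hu) (hdf a) (hdf b), hG y hy, hG y hy,
      hΓ' _ y hy (hdf a), hΓ' _ y hy (hdf b)] at h
    simpa [hφ.dchart_ofCoords _ hy, (hφ.coords_ofCoords_eventuallyEq _ hu).fderiv_eq] using h
  intro Y y hy hY v
  rw [hΓ' Y y hy hY v, key _ (φ.map_source hy)]

variable [J.Boundaryless]

/-- The covariant derivative whose value at `x` is given by the Christoffel symbols `Γ x` in the
preferred chart at `x`. -/
def covOfChristoffel (Γ : N → F →L[ℝ] F →L[ℝ] F) (Y : Π y : N, TangentSpace J y) (x : N) :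
    TangentSpace J x →L[ℝ] TangentSpace J x :=
  (dchart J (extChartAt J x) x).inverse.comp
    ((fderiv ℝ (coords J (extChartAt J x) Y) (extChartAt J x x) +
      (Γ x).flip (dchart J (extChartAt J x) x (Y x))).comp (dchart J (extChartAt J x) x))

omit [IsManifold J ∞ N] [FiniteDimensional ℝ F] [CompleteSpace F] [J.Boundaryless] in
lemma IsSmoothChart.dchart_inverse (hφ : IsSmoothChart J φ) {y : N} (hy : y ∈ φ.source) (a : F) :
    dchart J φ y ((dchart J φ y).inverse a) = a := by
  have h : (dchart J φ y).inverse = (hφ.derivEquiv hy).symm :=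
    ContinuousLinearMap.inverse_equiv (hφ.derivEquiv hy)
  rw [h]
  exact (hφ.derivEquiv hy).apply_symm_apply a

omit [FiniteDimensional ℝ F] [CompleteSpace F] in
lemma dchart_covOfChristoffel (Γ : N → F →L[ℝ] F →L[ℝ] F) (Y : Π y : N, TangentSpace J y) (x : N)
    (v : TangentSpace J x) :
    dchart J (extChartAt J x) x (covOfChristoffel Γ Y x v) =
      fderiv ℝ (coords J (extChartAt J x) Y) (extChartAt J x x) (dchart J (extChartAt J x) x v) +
        Γ x (dchart J (extChartAt J x) x v) (dchart J (extChartAt J x) x (Y x)) :=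
  (isSmoothChart_extChartAt x).dchart_inverse (mem_extChartAt_source x) _

/-- The connection whose value at `x` is given by the Christoffel symbols `Γ x` in the
preferred chart at `x`. -/
def connectionOfChristoffel (Γ : N → F →L[ℝ] F →L[ℝ] F) :
    CovariantDerivative J F (TangentSpace J : N → Type _) where
  toFun := covOfChristoffel Γ
  isCovariantDerivativeOnUniv :=
    { add := fun {Y Z x} hY hZ _ => by
        have hφ := isSmoothChart_extChartAt (J := J) x
        have hx := mem_extChartAt_source (I := J) x
        rw [hφ.mdifferentiableAt_iff _ hx] at hY hZ
        ext v
        refine hφ.dchart_injective hx ?_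
        change _ = dchart J (extChartAt J x) x (covOfChristoffel Γ Y x v + covOfChristoffel Γ Z x v)
        simp only [ContinuousLinearMap.map_add, dchart_covOfChristoffel, coords_add,
          fderiv_add hY hZ, clm_add_apply, Pi.add_apply]
        abel
      leibniz := fun {Y f x} hY hf _ => by
        have hφ := isSmoothChart_extChartAt (J := J) x
        have hx := mem_extChartAt_source (I := J) x
        ext v
        refine hφ.dchart_injective hx ?_
        change _ = dchart J (extChartAt J x) x
          (f x • covOfChristoffel Γ Y x v + mvfderiv J f x v • Y x)
        rw [dchart_covOfChristoffel, hφ.fderiv_coords_smul hx hf hY, Pi.smul_apply']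
        simp only [ContinuousLinearMap.map_add, ContinuousLinearMap.map_smul,
          dchart_covOfChristoffel]
        module }

omit [FiniteDimensional ℝ F] in
lemma dchart_connectionOfChristoffel (Γ : N → F →L[ℝ] F →L[ℝ] F) (Y : Π y : N, TangentSpace J y)
    (x : N) (v : TangentSpace J x) :
    dchart J (extChartAt J x) x (connectionOfChristoffel Γ Y x v) =
      fderiv ℝ (coords J (extChartAt J x) Y) (extChartAt J x x) (dchart J (extChartAt J x) x v) +
        Γ x (dchart J (extChartAt J x) x v) (dchart J (extChartAt J x) x (Y x)) :=
  dchart_covOfChristoffel Γ Y x v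

/-- Vanishing torsion and metric compatibility at `x` involve the connection only at `x`, so each
can be checked in the preferred chart at that point. No comparison of `Γ` between different charts
is needed. -/
lemma isLeviCivita_connectionOfChristoffel (Γ : N → F →L[ℝ] F →L[ℝ] F)
    (G : N → F → F →L[ℝ] F →L[ℝ] ℝ)
    (hG : ∀ x, g.HasComponents (extChartAt J x) (G x))
    (hd : ∀ x, DifferentiableAt ℝ (G x) (extChartAt J x x))
    (hs : ∀ x a b, Γ x a b = Γ x b a)
    (hm : ∀ x c a b, fderiv ℝ (G x) (extChartAt J x x) c a b =
      G x (extChartAt J x x) (Γ x c a) b + G x (extChartAt J x x) a (Γ x c b)) :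
    g.IsLeviCivita (connectionOfChristoffel Γ) := by
  constructor
  · rw [CovariantDerivative.torsion_eq_zero_iff]
    intro X Y x hX hY
    have hφ := isSmoothChart_extChartAt (J := J) x
    have hx := mem_extChartAt_source (I := J) x
    refine hφ.dchart_injective hx ?_
    rw [hφ.mdifferentiableAt_iff _ hx] at hX hY
    have h : dchart J (extChartAt J x) x (VectorField.mlieBracket J X Y x) = _ :=
      (IsSmoothChart.coords_apply _ hx).symm.trans
        (hφ.coords_mlieBracket ((extChartAt J x).map_source hx) hX hY)
    have hX' : coords J (extChartAt J x) X (extChartAt J x x) = dchart J (extChartAt J x) x (X x) :=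
      IsSmoothChart.coords_apply X hx
    have hY' : coords J (extChartAt J x) Y (extChartAt J x x) = dchart J (extChartAt J x) x (Y x) :=
      IsSmoothChart.coords_apply Y hx
    rw [h, ContinuousLinearMap.map_sub, dchart_connectionOfChristoffel,
      dchart_connectionOfChristoffel, VectorField.lieBracket, hX', hY', hs x _ (dchart J _ x (X x))]
    abel
  · intro x u Y Z hY hZ
    have hφ := isSmoothChart_extChartAt (J := J) x
    have hx := mem_extChartAt_source (I := J) x
    rw [(hG x).mvfderiv_eq hφ hx (hd x) hY hZ, hG x x hx, hG x x hx,
      dchart_connectionOfChristoffel, dchart_connectionOfChristoffel, hm]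
    simp only [ContinuousLinearMap.map_add, clm_add_apply]
    ring

end LeviCivita

/-! ### Smoothness of metrics and of Christoffel symbols. -/

section Smooth

variable {F : Type*} [NormedAddCommGroup F] [NormedSpace ℝ F]
  {H : Type*} [TopologicalSpace H] {J : ModelWithCorners ℝ F H}
  {N : Type*} [TopologicalSpace N] [ChartedSpace H N] [IsManifold J ∞ N]

lemma dchart_symmL (x : N) {y : N} (hy : y ∈ (chartAt H x).source) (a : F) :
    dchart J (extChartAt J x) y ((trivializationAt F (TangentSpace J) x).symmL ℝ y a) = a := by
  have hy' : y ∈ (trivializationAt F (TangentSpace J) x).baseSet := by simpa using hy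
  rw [dchart, ← TangentBundle.continuousLinearMapAt_trivializationAt hy]
  exact Trivialization.continuousLinearMapAt_symmL _ hy' _

variable [J.Boundaryless]

lemma contMDiff_of_components
    (val : Π x : N, TangentSpace J x →L[ℝ] TangentSpace J x →L[ℝ] ℝ)
    (G : N → F → F →L[ℝ] F →L[ℝ] ℝ) (hs : ∀ x, ContDiffOn ℝ ∞ (G x) (extChartAt J x).target)
    (hG : ∀ x, ∀ y ∈ (extChartAt J x).source, ∀ v w, val y v w =
      G x (extChartAt J x y) (dchart J (extChartAt J x) y v) (dchart J (extChartAt J x) y w)) :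
    ContMDiff J (J.prod 𝓘(ℝ, F →L[ℝ] F →L[ℝ] ℝ)) ∞
      (fun x => TotalSpace.mk' (F →L[ℝ] F →L[ℝ] ℝ)
        (E := fun x : N => TangentSpace J x →L[ℝ] TangentSpace J x →L[ℝ] ℝ) x (val x)) := by
  intro x
  rw [contMDiffAt_section]
  have hφ := isSmoothChart_extChartAt (J := J) x
  have h1 : ContMDiffAt J 𝓘(ℝ, F →L[ℝ] F →L[ℝ] ℝ) ∞ (G x ∘ extChartAt J x) x :=
    ((hs x).contDiffAt (hφ.isOpen_target.mem_nhds (mem_extChartAt_target x))).contMDiffAt.comp x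
      (hφ.contMDiffAt (mem_extChartAt_source x))
  refine h1.congr_of_eventuallyEq ?_
  filter_upwards [hφ.isOpen_source.mem_nhds (mem_extChartAt_source x)] with y hy
  have hy' : y ∈ (chartAt H x).source := by simpa using hy
  ext v w
  rw [Function.comp_apply]
  have h2 := hG x y hy ((trivializationAt F (TangentSpace J) x).symmL ℝ y v)
    ((trivializationAt F (TangentSpace J) x).symmL ℝ y w)
  rw [dchart_symmL x hy', dchart_symmL x hy'] at h2
  rw [← h2]
  simp only [hom_trivializationAt_apply, ContinuousLinearMap.inCoordinates]
  simp [hy', hom_trivializationAt_apply, ContinuousLinearMap.inCoordinates]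

variable [FiniteDimensional ℝ F] [CompleteSpace F] [T2Space N] {φ : PartialEquiv N F}

omit [J.Boundaryless] in
/-- A vector field on the domain of a chart agrees near any point with a global vector field. -/
lemma IsSmoothChart.exists_contMDiff_eventuallyEq (hφ : IsSmoothChart J φ) {y : N}
    (hy : y ∈ φ.source) (a : F) : ∃ X : Π y : N, TangentSpace J y,
      ContMDiff J J.tangent ∞ (fun y => (⟨y, X y⟩ : TangentBundle J N)) ∧
        ∀ᶠ z in nhds y, X z = ofCoords J φ (fun _ => a) z := by
  obtain ⟨f, -, hf⟩ := (SmoothBumpFunction.nhds_basis_tsupport (I := J) y).mem_iff.1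
    (hφ.isOpen_source.mem_nhds hy)
  refine ⟨fun z => f z • ofCoords J φ (fun _ => a) z, ?_, ?_⟩
  · exact ContMDiffOn.smul_section_of_tsupport f.contMDiff.contMDiffOn hφ.isOpen_source hf
      fun z hz => (hφ.contMDiffAt_ofCoords hz contDiffAt_const).contMDiffWithinAt
  · filter_upwards [f.eventuallyEq_one] with z hz
    rw [hz, Pi.one_apply, one_smul]

omit [J.Boundaryless] in
-- Near a given point, `Γ(a, b)` is the component of `∇_X Y` for global smooth fields `X`, `Y` that
-- have constant components `a`, `b` there. Global fields, obtained by a cutoff, are needed because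
-- smoothness of `D` is applied to fields on all of the manifold.
lemma HasChristoffel.contDiffOn {D : CovariantDerivative J F (TangentSpace J : N → Type _)}
    {Γ : F → F →L[ℝ] F →L[ℝ] F} (h : HasChristoffel D φ Γ) (hφ : IsSmoothChart J φ)
    (hD : D.ContMDiffCovariantDerivative ∞) : ContDiffOn ℝ ∞ Γ φ.target := by
  rw [contDiffOn_clm_apply]
  intro a
  rw [contDiffOn_clm_apply]
  intro b u hu
  have hy := φ.map_target hu
  obtain ⟨X, hX, hXa⟩ := hφ.exists_contMDiff_eventuallyEq hy a
  obtain ⟨Y, hY, hYb⟩ := hφ.exists_contMDiff_eventuallyEq hy b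
  have h1 := (hD.contMDiff.contMDiff (σ := Y) hY.contMDiffOn).contMDiffAt Filter.univ_mem
    (x := φ.symm u)
  have h2 : ContMDiffAt J J.tangent ∞ (fun y => (⟨y, nabla D X Y y⟩ : TangentBundle J N))
    (φ.symm u) := h1.clm_bundle_apply hX.contMDiffAt
  have h3 := hφ.contDiffAt_coords hy h2
  rw [φ.right_inv hu] at h3
  refine (h3.congr_of_eventuallyEq ?_).contDiffWithinAt
  have hc : ContinuousAt φ.symm u := (hφ.mdifferentiableAt_symm hu).continuousAt
  have e (Z : Π y : N, TangentSpace J y) (c : F)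
      (hZ : ∀ᶠ z in nhds (φ.symm u), Z z = ofCoords J φ (fun _ => c) z) :
      coords J φ Z =ᶠ[nhds u] fun _ => c := by
    filter_upwards [hc.eventually hZ, hφ.isOpen_target.mem_nhds hu] with w hw hw'
    rw [← hφ.coords_ofCoords (fun _ => c) hw', coords, coords, hw]
  -- `Y` is differentiated, so its components must be constant in a neighbourhood of each nearby
  -- `w`, hence `eventually_nhds`; for `X` the value at `w` is enough.
  filter_upwards [(e Y b hYb).eventually_nhds, e X a hXa, hφ.isOpen_target.mem_nhds hu]
    with w hw hw1 hw2
  have hw : coords J φ Y =ᶠ[nhds w] fun _ => b := hw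
  rw [h.coords_nabla hφ X Y hw2 ((differentiableAt_const b).congr_of_eventuallyEq hw), localNabla,
    hw1, hw.eq_of_nhds, hw.fderiv_eq]
  simp

end Smooth

/-! ### Coordinate changes and Christoffel symbols. -/

section Transition

variable {F : Type*} [NormedAddCommGroup F] [NormedSpace ℝ F]
  {H : Type*} [TopologicalSpace H] {J : ModelWithCorners ℝ F H}
  {N : Type*} [TopologicalSpace N] [ChartedSpace H N] {φ ψ : PartialEquiv N F}

/-- The domain, in the chart `φ`, of the coordinate change from `φ` to `ψ`. -/
def overlap (φ ψ : PartialEquiv N F) : Set F := φ.target ∩ φ.symm ⁻¹' ψ.source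

namespace IsSmoothChart

lemma isOpen_overlap (hφ : IsSmoothChart J φ) (hψ : IsSmoothChart J ψ) :
    IsOpen (overlap φ ψ) :=
  hφ.contMDiffOn_symm.continuousOn.isOpen_inter_preimage hφ.isOpen_target hψ.isOpen_source

lemma contDiffOn_transition (hφ : IsSmoothChart J φ) (hψ : IsSmoothChart J ψ) :
    ContDiffOn ℝ ∞ (ψ ∘ φ.symm) (overlap φ ψ) :=
  (hψ.contMDiffOn.comp (hφ.contMDiffOn_symm.mono Set.inter_subset_left)
    fun _ hu => hu.2).contDiffOn

lemma fderiv_transition (hφ : IsSmoothChart J φ) (hψ : IsSmoothChart J ψ) {u : F}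
    (hu : u ∈ overlap φ ψ) :
    fderiv ℝ (ψ ∘ φ.symm) u = (dchart J ψ (φ.symm u)).comp (dchartSymm J φ u) := by
  rw [← mfderiv_eq_fderiv]
  exact mfderiv_comp u (hψ.mdifferentiableAt hu.2) (hφ.mdifferentiableAt_symm hu.1)

lemma inverse_fderiv_transition (hφ : IsSmoothChart J φ) (hψ : IsSmoothChart J ψ) {u : F}
    (hu : u ∈ overlap φ ψ) :
    (fderiv ℝ (ψ ∘ φ.symm) u).IsInvertible ∧ (fderiv ℝ (ψ ∘ φ.symm) u).inverse =
      (dchart J φ (φ.symm u)).comp (dchart J ψ (φ.symm u)).inverse := by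
  have h (a : F) : (dchart J ψ (φ.symm u)).inverse (dchart J ψ (φ.symm u) a) = a :=
    hψ.dchart_injective hu.2 (hψ.dchart_inverse hu.2 _)
  let e : F ≃L[ℝ] F := ContinuousLinearEquiv.equivOfInverse (fderiv ℝ (ψ ∘ φ.symm) u)
    ((dchart J φ (φ.symm u)).comp (dchart J ψ (φ.symm u)).inverse)
    (fun a => by
      rw [hφ.fderiv_transition hψ hu]
      exact (congrArg (dchart J φ (φ.symm u)) (h _)).trans (hφ.dchart_dchartSymm hu.1 a))
    (fun a => by
      rw [hφ.fderiv_transition hψ hu]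
      exact (congrArg (dchart J ψ (φ.symm u)) (hφ.dchartSymm_dchart hu.1 _)).trans
        (hψ.dchart_inverse hu.2 a))
  exact ⟨⟨e, rfl⟩, ContinuousLinearMap.inverse_equiv e⟩

end IsSmoothChart

variable [IsManifold J ∞ N] [CompleteSpace F]
  {D : CovariantDerivative J F (TangentSpace J : N → Type _)} {Γ Γ' : F → F →L[ℝ] F →L[ℝ] F}

/-- The transformation law of Christoffel symbols. -/
lemma HasChristoffel.transition (hφ : IsSmoothChart J φ) (hψ : IsSmoothChart J ψ)
    (h : HasChristoffel D φ Γ) (h' : HasChristoffel D ψ Γ') {u : F} (hu : u ∈ overlap φ ψ)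
    (a b : F) :
    fderiv ℝ (ψ ∘ φ.symm) u (Γ u a b) = fderiv ℝ (fderiv ℝ (ψ ∘ φ.symm)) u a b +
      Γ' (ψ (φ.symm u)) (fderiv ℝ (ψ ∘ φ.symm) u a) (fderiv ℝ (ψ ∘ φ.symm) u b) := by
  have hW := hφ.isOpen_overlap hψ
  have hd (b : F) := hφ.mdifferentiableAt_ofCoords (f := fun _ => b) (φ.map_target hu.1)
    (differentiableAt_const b)
  have h1 := h _ _ (φ.map_target hu.1) (hd b) (dchartSymm J φ u a)
  have h2 := h' _ _ hu.2 (hd b) (dchartSymm J φ u a)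
  rw [hφ.dchart_ofCoords _ (φ.map_target hu.1), hφ.dchart_dchartSymm hu.1, φ.right_inv hu.1,
    (hφ.coords_ofCoords_eventuallyEq _ hu.1).fderiv_eq, fderiv_fun_const] at h1
  have h3 : D (ofCoords J φ fun _ => b) (φ.symm u) (dchartSymm J φ u a) =
      dchartSymm J φ u (Γ u a b) := by
    refine hφ.dchart_injective (φ.map_target hu.1) ?_
    rw [h1, hφ.dchart_dchartSymm hu.1]
    simp
  have h4 (w : F) (hw : w ∈ overlap φ ψ) :
      dchart J ψ (φ.symm w) (ofCoords J φ (fun _ => b) (φ.symm w)) =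
        fderiv ℝ (ψ ∘ φ.symm) w b := by
    rw [hφ.fderiv_transition hψ hw, ContinuousLinearMap.comp_apply]
    congr 1
    refine hφ.dchart_injective (φ.map_target hw.1) ?_
    rw [hφ.dchart_ofCoords _ (φ.map_target hw.1), hφ.dchart_dchartSymm hw.1]
  -- In the chart `ψ` the coordinate field of `φ` in direction `b` has components `w ↦ Dτ_w b`, with
  -- `τ` the coordinate change. Its derivative is the source of the inhomogeneous second-derivative
  -- term.
  have h5 : coords J ψ (ofCoords J φ fun _ => b) ∘ (ψ ∘ φ.symm) =ᶠ[nhds u]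
      fun w => fderiv ℝ (ψ ∘ φ.symm) w b := by
    filter_upwards [hW.mem_nhds hu] with w hw
    rw [← h4 w hw]
    exact IsSmoothChart.coords_apply _ hw.2
  have hτ := (hφ.contDiffOn_transition hψ).differentiableAt_of_isOpen hW hu
  have hτ' : DifferentiableAt ℝ (fderiv ℝ (ψ ∘ φ.symm)) u :=
    ((hφ.contDiffOn_transition hψ).fderiv_of_isOpen hW (m := ∞)
      (by simp)).differentiableAt_of_isOpen hW hu
  have h6 : DifferentiableAt ℝ (coords J ψ (ofCoords J φ fun _ => b)) ((ψ ∘ φ.symm) u) :=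
    (hψ.mdifferentiableAt_iff _ hu.2).1 (hd b)
  have h7 := h5.fderiv_eq (𝕜 := ℝ)
  rw [fderiv_comp u h6 hτ,
    (hτ'.hasFDerivAt.clm_apply (hasFDerivAt_const b u)).fderiv] at h7
  have h8 := congrArg (fun L : F →L[ℝ] F => L a) h7
  have h9 : fderiv ℝ (coords J ψ (ofCoords J φ fun _ => b)) (ψ (φ.symm u))
      (fderiv ℝ (ψ ∘ φ.symm) u a) = fderiv ℝ (fderiv ℝ (ψ ∘ φ.symm)) u a b := by
    simpa using h8
  rw [h3, h4 u hu] at h2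
  rw [hφ.fderiv_transition hψ hu] at h2 h9 ⊢
  rw [← h9]
  exact h2

end Transition

/-! ### Induced coordinate changes on covectors. -/

section CotangentTransition

variable {E : Type*} [NormedAddCommGroup E] [NormedSpace ℝ E]

/-- The coordinate change on the cotangent bundle induced by the coordinate change `τ`. -/
def cotangentTransition (τ : E → E) (z : E × (E →L[ℝ] ℝ)) : E × (E →L[ℝ] ℝ) :=
  (τ z.1, z.2.comp (fderiv ℝ τ z.1).inverse)

variable [CompleteSpace E] {τ : E → E} {U : Set E}

lemma differentiableAt_cotangentTransition (hU : IsOpen U) (hτ : ContDiffOn ℝ ∞ τ U)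
    {z : E × (E →L[ℝ] ℝ)} (hz : z.1 ∈ U) (hi : (fderiv ℝ τ z.1).IsInvertible) :
    DifferentiableAt ℝ (cotangentTransition τ) z := by
  have h1 := hτ.differentiableAt_of_isOpen hU hz
  have h2 : ContDiffAt ℝ ∞ (fderiv ℝ τ) z.1 :=
    (hτ.fderiv_of_isOpen hU (m := ∞) (by simp)).contDiffAt (hU.mem_nhds hz)
  obtain ⟨e, he⟩ := hi
  have h3 : DifferentiableAt ℝ (fun w => (fderiv ℝ τ w).inverse) z.1 :=
    (ContDiffAt.comp z.1 (g := ContinuousLinearMap.inverse) (n := ∞)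
      (he ▸ contDiffAt_map_inverse e) h2).differentiableAt (by simp)
  have h4 : DifferentiableAt ℝ (fun z : E × (E →L[ℝ] ℝ) => (fderiv ℝ τ z.1).inverse) z :=
    h3.comp z differentiableAt_fst
  exact (h1.comp z differentiableAt_fst).prodMk (differentiableAt_snd.clm_comp h4)

lemma fderiv_cotangentTransition (hU : IsOpen U) (hτ : ContDiffOn ℝ ∞ τ U)
    (hi : ∀ u ∈ U, (fderiv ℝ τ u).IsInvertible) {z : E × (E →L[ℝ] ℝ)} (hz : z.1 ∈ U)
    (t : E × (E →L[ℝ] ℝ)) :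
    (fderiv ℝ (cotangentTransition τ) z t).1 = fderiv ℝ τ z.1 t.1 ∧
    ∀ b, (fderiv ℝ (cotangentTransition τ) z t).2 (fderiv ℝ τ z.1 b) = t.2 b -
      z.2 ((fderiv ℝ τ z.1).inverse (fderiv ℝ (fderiv ℝ τ) z.1 t.1 b)) := by
  have hT := differentiableAt_cotangentTransition hU hτ hz (hi _ hz)
  have hτ1 := hτ.differentiableAt_of_isOpen hU hz
  have hτ2 : DifferentiableAt ℝ (fderiv ℝ τ) z.1 :=
    (hτ.fderiv_of_isOpen hU (m := ∞) (by simp)).differentiableAt_of_isOpen hU hz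
  constructor
  · rw [fderiv_fst_comp hT]
    exact fderiv_comp_fst hτ1 t
  · intro b
    -- The covector part is characterized by `T(w).2 (Dτ b) = w.2 b`. Differentiating this identity
    -- avoids differentiating the inverse of `Dτ`.
    have h1 : (fun w : E × (E →L[ℝ] ℝ) => (cotangentTransition τ w).2 (fderiv ℝ τ w.1 b)) =ᶠ[nhds z]
        fun w => w.2 b := by
      filter_upwards [continuousAt_fst.preimage_mem_nhds (hU.mem_nhds hz)] with w hw
      obtain ⟨e, he⟩ := hi w.1 hw
      simp [cotangentTransition, ← he]
    have h2 : HasFDerivAt (fun w : E × (E →L[ℝ] ℝ) => fderiv ℝ τ w.1) _ z :=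
      hτ2.hasFDerivAt.comp z hasFDerivAt_fst
    have h3 := hT.hasFDerivAt.snd.clm_apply (h2.clm_apply (hasFDerivAt_const b z))
    have h4 : HasFDerivAt (fun w : E × (E →L[ℝ] ℝ) => w.2 b) _ z :=
      hasFDerivAt_snd.clm_apply (hasFDerivAt_const b z)
    have h5 := congrArg (fun L : E × (E →L[ℝ] ℝ) →L[ℝ] ℝ => L t)
      (h3.unique (h4.congr_of_eventuallyEq h1))
    have h6 : z.2 ((fderiv ℝ τ z.1).inverse (fderiv ℝ (fderiv ℝ τ) z.1 t.1 b)) +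
        (fderiv ℝ (cotangentTransition τ) z t).2 (fderiv ℝ τ z.1 b) = t.2 b := by
      simpa [cotangentTransition] using h5
    linarith

end CotangentTransition

/-! ### Induced coordinates against the preferred charts of the cotangent bundle. -/

section CotangentChart

variable {E : Type*} [NormedAddCommGroup E] [NormedSpace ℝ E]
  {M : Type*} [TopologicalSpace M] [ChartedSpace E M]

lemma isSmoothChart_of_mem_maximalAtlas {c : OpenPartialHomeomorph M E}
    (hc : c ∈ IsManifold.maximalAtlas 𝓘(ℝ, E) ∞ M) : IsSmoothChart 𝓘(ℝ, E) c.toPartialEquiv where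
  isOpen_source := c.open_source
  isOpen_target := c.open_target
  contMDiffOn := contMDiffOn_of_mem_maximalAtlas hc
  contMDiffOn_symm := contMDiffOn_symm_of_mem_maximalAtlas hc

variable [IsManifold 𝓘(ℝ, E) ∞ M]

lemma christoffel_eq [FiniteDimensional ℝ E] [CompleteSpace E]
    {D : CovariantDerivative 𝓘(ℝ, E) E (TangentSpace 𝓘(ℝ, E) : M → Type _)}
    {c : OpenPartialHomeomorph M E} (hc : IsSmoothChart 𝓘(ℝ, E) c.toPartialEquiv)
    {Γ : E → E →L[ℝ] E →L[ℝ] E} (h : HasChristoffel D c.toPartialEquiv Γ) {u : E}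
    (hu : u ∈ c.target) (a b : E) : christoffel D c u a b = Γ u a b := by
  have hd : DifferentiableAt ℝ (coords 𝓘(ℝ, E) c.toPartialEquiv
      (ofCoords 𝓘(ℝ, E) c.toPartialEquiv fun _ => b)) u :=
    (differentiableAt_const b).congr_of_eventuallyEq (hc.coords_ofCoords_eventuallyEq _ hu)
  have h1 := h.coords_nabla hc (ofCoords 𝓘(ℝ, E) c.toPartialEquiv fun _ => a) _ hu hd
  rw [localNabla, hc.coords_ofCoords _ hu, hc.coords_ofCoords _ hu,
    (hc.coords_ofCoords_eventuallyEq _ hu).fderiv_eq] at h1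
  refine (Eq.trans ?_ h1).trans (by simp)
  rfl

variable (E) in
/-- The model with corners of the cotangent bundle. -/
abbrev cotangentModel : ModelWithCorners ℝ (E × (E →L[ℝ] ℝ)) (ModelProd E (E →L[ℝ] ℝ)) :=
  𝓘(ℝ, E).prod 𝓘(ℝ, E →L[ℝ] ℝ)

lemma mem_extChartAt_source_cotangent (θ θ' : Cotangent E M) :
    θ' ∈ (extChartAt (cotangentModel E) θ).source ↔ θ'.proj ∈ (chartAt E θ.proj).source := by
  rw [extChartAt_source, FiberBundle.chartedSpace_chartAt]
  simp only [mfld_simps]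
  simp
  exact fun h => h

lemma mem_extChartAt_target_cotangent (θ : Cotangent E M) (z : E × (E →L[ℝ] ℝ)) :
    z ∈ (extChartAt (cotangentModel E) θ).target ↔ z.1 ∈ (extChartAt 𝓘(ℝ, E) θ.proj).target := by
  rw [FiberBundle.extChartAt_target]
  simp only [Set.mem_prod, Set.mem_univ, and_true, Set.mem_inter_iff, Set.mem_preimage,
    and_iff_left_iff_imp]
  intro h
  have := (extChartAt 𝓘(ℝ, E) θ.proj).map_target h
  simp only [extChartAt_source] at this
  simpa using this

lemma extChartAt_cotangent_apply (θ θ' : Cotangent E M)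
    (h : θ'.proj ∈ (chartAt E θ.proj).source) :
    extChartAt (cotangentModel E) θ θ' = (extChartAt 𝓘(ℝ, E) θ.proj θ'.proj,
      θ'.2.comp (dchart 𝓘(ℝ, E) (extChartAt 𝓘(ℝ, E) θ.proj) θ'.proj).inverse) := by
  have hφ := isSmoothChart_extChartAt (J := 𝓘(ℝ, E)) θ.proj
  have h' : θ'.proj ∈ (extChartAt 𝓘(ℝ, E) θ.proj).source := by rwa [extChartAt_source]
  rw [FiberBundle.extChartAt]
  refine Prod.ext rfl ?_
  change (trivializationAt (E →L[ℝ] ℝ) (fun x : M => TangentSpace 𝓘(ℝ, E) x →L[ℝ] ℝ) θ.proj θ').2 =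
    _
  ext a
  have e : (dchart 𝓘(ℝ, E) (extChartAt 𝓘(ℝ, E) θ.proj) θ'.proj).inverse a =
      (trivializationAt E (TangentSpace 𝓘(ℝ, E)) θ.proj).symmL ℝ θ'.proj a := by
    refine hφ.dchart_injective h' ?_
    rw [dchart_symmL _ h, hφ.dchart_inverse h']
  rw [ContinuousLinearMap.comp_apply, e, hom_trivializationAt_apply]
  simp [ContinuousLinearMap.inCoordinates]

variable [FiniteDimensional ℝ E] [CompleteSpace E] {c : OpenPartialHomeomorph M E}

omit [FiniteDimensional ℝ E] [CompleteSpace E] in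
lemma extChartAt_inducedChartSymm (hc : IsSmoothChart 𝓘(ℝ, E) c.toPartialEquiv) (p : M)
    (θ : Cotangent E M) (hθ : θ.proj = p) {z : E × (E →L[ℝ] ℝ)}
    (hz : z.1 ∈ overlap c.toPartialEquiv (extChartAt 𝓘(ℝ, E) p)) :
    extChartAt (cotangentModel E) θ (inducedChartSymm c z) =
      cotangentTransition (extChartAt 𝓘(ℝ, E) p ∘ c.symm) z := by
  subst hθ
  have hφ := isSmoothChart_extChartAt (J := 𝓘(ℝ, E)) θ.proj
  have h := hz.2
  rw [Set.mem_preimage, extChartAt_source] at h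
  rw [extChartAt_cotangent_apply θ _ h, cotangentTransition]
  refine Prod.ext rfl ?_
  have h1 := (hc.inverse_fderiv_transition hφ hz).2
  change _ = z.2.comp (fderiv ℝ (extChartAt 𝓘(ℝ, E) θ.proj ∘ c.toPartialEquiv.symm) z.1).inverse
  rw [h1]
  rfl

omit [FiniteDimensional ℝ E] in
-- Near `z` the map is the inverse of a preferred chart of `T*M` composed with the explicit
-- `cotangentTransition`, both of which are differentiable.
lemma mdifferentiableAt_inducedChartSymm (hc : IsSmoothChart 𝓘(ℝ, E) c.toPartialEquiv)
    {z : E × (E →L[ℝ] ℝ)} (hz : z.1 ∈ c.target) :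
    MDifferentiableAt 𝓘(ℝ, E × (E →L[ℝ] ℝ)) (cotangentModel E) (inducedChartSymm (M := M) c) z := by
  let θ : Cotangent E M := inducedChartSymm c z
  have hφ := isSmoothChart_extChartAt (J := 𝓘(ℝ, E)) θ.proj
  have hΦ := isSmoothChart_extChartAt (J := cotangentModel E) θ
  have hz' : z.1 ∈ overlap c.toPartialEquiv (extChartAt 𝓘(ℝ, E) θ.proj) :=
    ⟨hz, mem_extChartAt_source _⟩
  have hW := hc.isOpen_overlap hφ
  have hT := differentiableAt_cotangentTransition hW (hc.contDiffOn_transition hφ) hz'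
    (hc.inverse_fderiv_transition hφ hz').1
  have hTz : cotangentTransition (extChartAt 𝓘(ℝ, E) θ.proj ∘ c.toPartialEquiv.symm) z =
      extChartAt (cotangentModel E) θ θ := (extChartAt_inducedChartSymm hc θ.proj θ rfl hz').symm
  have h1 : MDifferentiableAt 𝓘(ℝ, E × (E →L[ℝ] ℝ)) (cotangentModel E)
      (extChartAt (cotangentModel E) θ).symm
      (cotangentTransition (extChartAt 𝓘(ℝ, E) θ.proj ∘ c.toPartialEquiv.symm) z) := by
    rw [hTz]
    exact hΦ.mdifferentiableAt_symm (mem_extChartAt_target θ)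
  refine (h1.comp z hT.mdifferentiableAt).congr_of_eventuallyEq ?_
  filter_upwards [continuousAt_fst.preimage_mem_nhds (hW.mem_nhds hz')] with w hw
  refine Eq.trans ?_ (congrArg (extChartAt (cotangentModel E) θ).symm
    (extChartAt_inducedChartSymm hc θ.proj θ rfl hw))
  rw [(extChartAt (cotangentModel E) θ).left_inv]
  rw [mem_extChartAt_source_cotangent, ← extChartAt_source 𝓘(ℝ, E)]
  exact hw.2

omit [FiniteDimensional ℝ E] in
lemma dchart_inducedCoordVector (hc : IsSmoothChart 𝓘(ℝ, E) c.toPartialEquiv) (p : M)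
    (θ : Cotangent E M) (hθ : θ.proj = p) {z : E × (E →L[ℝ] ℝ)}
    (hz : z.1 ∈ overlap c.toPartialEquiv (extChartAt 𝓘(ℝ, E) p)) (t : E × (E →L[ℝ] ℝ)) :
    dchart (cotangentModel E) (extChartAt (cotangentModel E) θ) (inducedChartSymm c z)
        (inducedCoordVector c z t) =
      fderiv ℝ (cotangentTransition (extChartAt 𝓘(ℝ, E) p ∘ c.symm)) z t := by
  have hφ := isSmoothChart_extChartAt (J := 𝓘(ℝ, E)) p
  have hΦ := isSmoothChart_extChartAt (J := cotangentModel E) θ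
  have hs : inducedChartSymm c z ∈ (extChartAt (cotangentModel E) θ).source := by
    rw [mem_extChartAt_source_cotangent, ← extChartAt_source 𝓘(ℝ, E), hθ]
    exact hz.2
  have e : cotangentTransition (extChartAt 𝓘(ℝ, E) p ∘ c.symm) =ᶠ[nhds z]
      extChartAt (cotangentModel E) θ ∘ inducedChartSymm c := by
    filter_upwards [continuousAt_fst.preimage_mem_nhds ((hc.isOpen_overlap hφ).mem_nhds hz)]
      with w hw using (extChartAt_inducedChartSymm hc p θ hθ hw).symm
  rw [e.fderiv_eq, ← mfderiv_eq_fderiv, mfderiv_comp z (hΦ.mdifferentiableAt hs)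
    (mdifferentiableAt_inducedChartSymm hc hz.1)]
  rfl

omit [IsManifold 𝓘(ℝ, E) ∞ M] [FiniteDimensional ℝ E] [CompleteSpace E] in
lemma exists_inducedChartSymm_eq (hc : IsSmoothChart 𝓘(ℝ, E) c.toPartialEquiv)
    (θ : Cotangent E M) (hθ : θ.proj ∈ c.source) :
    ∃ u ∈ c.target, ∃ ξ, inducedChartSymm c (u, ξ) = θ := by
  obtain ⟨p, α⟩ := θ
  obtain ⟨u, hu, rfl⟩ : ∃ u ∈ c.target, c.symm u = p := ⟨c p, c.map_source hθ, c.left_inv hθ⟩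
  refine ⟨u, hu, α.comp (dchart 𝓘(ℝ, E) c.toPartialEquiv (c.symm u)).inverse, ?_⟩
  rw [inducedChartSymm]
  congr 1
  ext v
  exact congrArg α (hc.dchart_injective hθ (hc.dchart_inverse hθ _))

/-- The derivative of the induced coordinate change is triangular with invertible diagonal, hence
injective, hence surjective by equality of finite dimensions. -/
lemma inducedCoordVector_surjective (hc : IsSmoothChart 𝓘(ℝ, E) c.toPartialEquiv)
    {z : E × (E →L[ℝ] ℝ)} (hz : z.1 ∈ c.target) :
    Function.Surjective (inducedCoordVector (M := M) c z) := by
  let θ : Cotangent E M := inducedChartSymm c z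
  have hφ := isSmoothChart_extChartAt (J := 𝓘(ℝ, E)) θ.proj
  have hΦ := isSmoothChart_extChartAt (J := cotangentModel E) θ
  have hz' : z.1 ∈ overlap c.toPartialEquiv (extChartAt 𝓘(ℝ, E) θ.proj) :=
    ⟨hz, mem_extChartAt_source _⟩
  obtain ⟨⟨e, he⟩, -⟩ := hc.inverse_fderiv_transition hφ hz'
  have hT := fderiv_cotangentTransition (hc.isOpen_overlap hφ) (hc.contDiffOn_transition hφ)
    (fun u hu => (hc.inverse_fderiv_transition hφ hu).1) hz'
  rw [← he] at hT
  have hinj : Function.Injective (fderiv ℝ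
      (cotangentTransition (extChartAt 𝓘(ℝ, E) θ.proj ∘ c.toPartialEquiv.symm)) z) := by
    rw [injective_iff_map_eq_zero]
    intro t ht
    have h1 : t.1 = 0 := by
      have := (hT t).1
      rw [ht] at this
      exact e.injective (this.symm.trans e.map_zero.symm)
    refine Prod.ext h1 (ContinuousLinearMap.ext fun b => ?_)
    have h2 := (hT t).2 b
    rw [ht, h1] at h2
    simpa using h2.symm
  intro v
  obtain ⟨t, ht⟩ := (LinearMap.injective_iff_surjective (f := (fderiv ℝ
    (cotangentTransition (extChartAt 𝓘(ℝ, E) θ.proj ∘ c.toPartialEquiv.symm)) z).toLinearMap)).1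
      hinj (dchart (cotangentModel E) (extChartAt (cotangentModel E) θ) θ v)
  exact ⟨t, hΦ.dchart_injective (mem_extChartAt_source θ)
    ((dchart_inducedCoordVector hc θ.proj θ rfl hz' t).trans ht)⟩

omit [FiniteDimensional ℝ E] in
/-- The form `extForm` is invariant under coordinate changes. -/
lemma extForm_cotangentTransition {φ ψ : PartialEquiv M E} (hφ : IsSmoothChart 𝓘(ℝ, E) φ)
    (hψ : IsSmoothChart 𝓘(ℝ, E) ψ)
    {D : CovariantDerivative 𝓘(ℝ, E) E (TangentSpace 𝓘(ℝ, E) : M → Type _)}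
    {Γ Γ' : E → E →L[ℝ] E →L[ℝ] E} (h : HasChristoffel D φ Γ) (h' : HasChristoffel D ψ Γ')
    {z : E × (E →L[ℝ] ℝ)} (hz : z.1 ∈ overlap φ ψ) (s t : E × (E →L[ℝ] ℝ)) :
    extForm (cotangentTransition (ψ ∘ φ.symm) z).2 (Γ' (ψ (φ.symm z.1)))
        (fderiv ℝ (cotangentTransition (ψ ∘ φ.symm)) z s)
        (fderiv ℝ (cotangentTransition (ψ ∘ φ.symm)) z t) =
      extForm z.2 (Γ z.1) s t := by
  have hT := fderiv_cotangentTransition (hφ.isOpen_overlap hψ) (hφ.contDiffOn_transition hψ)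
    (fun u hu => (hφ.inverse_fderiv_transition hψ hu).1) hz
  have hs : IsSymmSndFDerivAt ℝ (ψ ∘ φ.symm) z.1 :=
    ((hφ.contDiffOn_transition hψ).contDiffAt
      ((hφ.isOpen_overlap hψ).mem_nhds hz)).isSymmSndFDerivAt (by simpa using two_le_infty)
  have hΓ := HasChristoffel.transition hφ hψ h h' hz s.1 t.1
  obtain ⟨⟨e, he⟩, -⟩ := hφ.inverse_fderiv_transition hψ hz
  -- The transformation law contributes `+2 z.2(Dτ⁻¹ D²τ(s, t))`; each of the two pairing terms
  -- contributes `-z.2(Dτ⁻¹ D²τ(s, t))`, the second after exchanging the arguments of `D²τ`.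
  rw [extForm_apply, extForm_apply, (hT s).1, (hT t).1, (hT s).2, (hT t).2,
    cotangentTransition, hs t.1 s.1, eq_sub_of_add_eq' hΓ.symm]
  simp only [← he, ContinuousLinearMap.inverse_equiv, ContinuousLinearMap.comp_apply,
    ContinuousLinearMap.map_sub]
  simp
  ring

end CotangentChart

/-! ### The Riemannian extension: existence, uniqueness, signature. -/

section RiemannianExtension

variable {E : Type*} [NormedAddCommGroup E] [NormedSpace ℝ E] [FiniteDimensional ℝ E]

lemma exists_orthonormal_basis_extForm (ξ : E →L[ℝ] ℝ) {B : E →L[ℝ] E →L[ℝ] E}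
    (hB : ∀ a b, B a b = B b a) :
    ∃ b : Module.Basis (Fin (Module.finrank ℝ E) ⊕ Fin (Module.finrank ℝ E)) ℝ
        (E × (E →L[ℝ] ℝ)),
      (∀ i j, i ≠ j → extForm ξ B (b i) (b j) = 0) ∧
      (∀ i, extForm ξ B (b (Sum.inl i)) (b (Sum.inl i)) = 1) ∧
      (∀ i, extForm ξ B (b (Sum.inr i)) (b (Sum.inr i)) = -1) := by
  let e := Module.finBasis ℝ E
  let ε (i) : E →L[ℝ] ℝ := LinearMap.toContinuousLinearMap (e.coord i)
  -- The summand `ξ ∘ B(e i)` absorbs the term `-2 ξ(B(·,·))`, making the form the bare pairing.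
  -- With weights `r/2` and `s/2` the product of `f r i` and `f s j` is `(r + s)/2` for `i = j` and
  -- zero otherwise, so `r = 1` and `r = -1` give orthogonal families of opposite sign.
  let f (r : ℝ) (i) : E × (E →L[ℝ] ℝ) := (e i, ξ.comp (B (e i)) + (r / 2) • ε i)
  have hε (i j) : ε i (e j) = if i = j then 1 else 0 := by
    change e.coord i (e j) = _
    rw [Module.Basis.coord_apply, Module.Basis.repr_self, Finsupp.single_apply]
    simp only [eq_comm]
  have hf (r s : ℝ) (i j) : extForm ξ B (f r i) (f s j) = if i = j then (r + s) / 2 else 0 := by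
    rw [extForm_apply]
    simp only [f, clm_add_apply, clm_smul_apply, ContinuousLinearMap.comp_apply, hε,
      hB (e j) (e i), smul_eq_mul]
    by_cases h : i = j
    · simp only [h, if_true]; ring
    · simp only [if_neg h, if_neg (Ne.symm h)]; ring
  let v : Fin (Module.finrank ℝ E) ⊕ Fin (Module.finrank ℝ E) → E × (E →L[ℝ] ℝ) :=
    Sum.elim (f 1) (f (-1))
  have hv (i j) (hij : i ≠ j) : extForm ξ B (v i) (v j) = 0 := by
    rcases i with i | i <;> rcases j with j | j <;> simp only [v, Sum.elim_inl, Sum.elim_inr, hf]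
    · exact if_neg fun h => hij (congrArg _ h)
    · simp
    · simp
    · exact if_neg fun h => hij (congrArg _ h)
  have h1 (i) : extForm ξ B (v (Sum.inl i)) (v (Sum.inl i)) = 1 := by
    simp [v, hf]
  have h2 (i) : extForm ξ B (v (Sum.inr i)) (v (Sum.inr i)) = -1 := by
    simp only [v, Sum.elim_inr, hf]; norm_num
  have hne (i) : extForm ξ B (v i) (v i) ≠ 0 := by
    rcases i with i | i
    · rw [h1]; norm_num
    · rw [h2]; norm_num
  have hli : LinearIndependent ℝ v := by
    rw [Fintype.linearIndependent_iff]
    intro c hc i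
    -- Pairing a linear relation with `v i` isolates the `i`-th coefficient times a nonzero norm.
    have h := congrArg (fun x => extForm ξ B x (v i)) hc
    simp only [map_sum, ContinuousLinearMap.map_smul, ContinuousLinearMap.map_zero, sum_apply,
      clm_smul_apply] at h
    rw [Finset.sum_eq_single i (fun j _ hj => by rw [hv j i hj, smul_zero]) (by simp)] at h
    exact (smul_eq_zero.1 h).resolve_right (hne i)
  have hcard : Fintype.card (Fin (Module.finrank ℝ E) ⊕ Fin (Module.finrank ℝ E)) =
      Module.finrank ℝ (E × (E →L[ℝ] ℝ)) := by
    rw [Module.finrank_prod, ← (LinearMap.toContinuousLinearMap (𝕜 := ℝ) (E := E)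
      (F' := ℝ)).finrank_eq]
    simp
  refine ⟨Module.Basis.mk hli (hli.span_eq_top_of_card_eq_finrank' hcard).ge, ?_, ?_, ?_⟩ <;>
    simp only [Module.Basis.mk_apply]
  exacts [hv, h1, h2]

lemma contDiffOn_extForm {Γ : E → E →L[ℝ] E →L[ℝ] E} {U : Set E} (hΓ : ContDiffOn ℝ ∞ Γ U) :
    ContDiffOn ℝ ∞ (fun z : E × (E →L[ℝ] ℝ) => extForm z.2 (Γ z.1)) (U ×ˢ Set.univ) := by
  rw [contDiffOn_clm_apply]
  intro v
  rw [contDiffOn_clm_apply]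
  intro w
  have h1 : ContDiffOn ℝ ∞ (fun z : E × (E →L[ℝ] ℝ) => Γ z.1) (U ×ˢ Set.univ) :=
    hΓ.comp contDiffOn_fst fun z hz => hz.1
  have h2 : ContDiffOn ℝ ∞ (fun z : E × (E →L[ℝ] ℝ) => z.2 (Γ z.1 v.1 w.1)) (U ×ˢ Set.univ) :=
    contDiffOn_snd.clm_apply ((h1.clm_apply contDiffOn_const).clm_apply contDiffOn_const)
  simp only [extForm_apply]
  exact ((contDiffOn_const.mul h2).add contDiffOn_const).add contDiffOn_const

variable {M : Type*} [TopologicalSpace M] [ChartedSpace E M] [IsManifold 𝓘(ℝ, E) ∞ M]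

omit [FiniteDimensional ℝ E] in
lemma extChartAt_target_cotangent (θ : Cotangent E M) :
    (extChartAt (cotangentModel E) θ).target =
      (extChartAt 𝓘(ℝ, E) θ.proj).target ×ˢ Set.univ := by
  ext z
  rw [mem_extChartAt_target_cotangent]
  simp

variable [CompleteSpace E]
  (D : CovariantDerivative 𝓘(ℝ, E) E (TangentSpace 𝓘(ℝ, E) : M → Type _))

/-- The Christoffel symbols of `D` in the preferred chart at `p`. -/
def christoffelAt (p : M) : E → E →L[ℝ] E →L[ℝ] E :=
  Classical.choose ((isSmoothChart_extChartAt (J := 𝓘(ℝ, E)) p).exists_hasChristoffel D)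

lemma hasChristoffel_christoffelAt (p : M) :
    HasChristoffel D (extChartAt 𝓘(ℝ, E) p) (christoffelAt D p) :=
  Classical.choose_spec ((isSmoothChart_extChartAt (J := 𝓘(ℝ, E)) p).exists_hasChristoffel D)

/-- The Riemannian extension of `D`, as a form on the tangent space at `θ`. -/
def riemannianExtensionForm (θ : Cotangent E M) : TangentSpace (cotangentModel E) θ →L[ℝ]
    TangentSpace (cotangentModel E) θ →L[ℝ] ℝ :=
  (ContinuousLinearMap.precomp ℝ
      (dchart (cotangentModel E) (extChartAt (cotangentModel E) θ) θ)).comp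
    ((extForm (extChartAt (cotangentModel E) θ θ).2
      (christoffelAt D θ.proj (extChartAt 𝓘(ℝ, E) θ.proj θ.proj))).comp
      (dchart (cotangentModel E) (extChartAt (cotangentModel E) θ) θ))

lemma riemannianExtensionForm_apply (θ : Cotangent E M)
    (v w : TangentSpace (cotangentModel E) θ) :
    riemannianExtensionForm D θ v w = extForm (extChartAt (cotangentModel E) θ θ).2
      (christoffelAt D θ.proj (extChartAt 𝓘(ℝ, E) θ.proj θ.proj))
      (dchart (cotangentModel E) (extChartAt (cotangentModel E) θ) θ v)
      (dchart (cotangentModel E) (extChartAt (cotangentModel E) θ) θ w) := rfl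

/-- The family of forms `val` has the components of the Riemannian extension of `D` in all
induced charts. -/
def IsExtensionForm (val : Π θ : Cotangent E M, TangentSpace (cotangentModel E) θ →L[ℝ]
    TangentSpace (cotangentModel E) θ →L[ℝ] ℝ) : Prop :=
  ∀ c ∈ IsManifold.maximalAtlas 𝓘(ℝ, E) ∞ M, ∀ u ∈ c.target, ∀ ξ : E →L[ℝ] ℝ,
    ∀ (a b : E) (α β : E →L[ℝ] ℝ),
      val (inducedChartSymm c (u, ξ))
          (inducedCoordVector c (u, ξ) (a, α)) (inducedCoordVector c (u, ξ) (b, β)) =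
        -2 * ξ (christoffel D c u a b) + α b + β a

lemma isExtensionForm_riemannianExtensionForm : IsExtensionForm D (riemannianExtensionForm D) := by
  intro c hc u hu ξ a b α β
  have hc' := isSmoothChart_of_mem_maximalAtlas hc
  obtain ⟨Γ, hΓ⟩ := hc'.exists_hasChristoffel D
  have hz : u ∈ overlap c.toPartialEquiv (extChartAt 𝓘(ℝ, E) (c.symm u)) :=
    ⟨hu, mem_extChartAt_source _⟩
  have h := extForm_cotangentTransition hc' (isSmoothChart_extChartAt (c.symm u)) hΓ
    (hasChristoffel_christoffelAt D (c.symm u)) (z := (u, ξ)) hz (a, α) (b, β)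
  rw [christoffel_eq hc' hΓ hu, riemannianExtensionForm_apply]
  have e := dchart_inducedCoordVector hc' (c.symm u) (inducedChartSymm c (u, ξ)) rfl
    (z := (u, ξ)) hz
  have e' := extChartAt_inducedChartSymm hc' (c.symm u) (inducedChartSymm c (u, ξ)) rfl
    (z := (u, ξ)) hz
  rw [e, e, e']
  refine Eq.trans h ?_
  rw [extForm_apply]

variable {D}

/-- Induced coordinates reach every covector over the chart domain and every tangent vector there,
so the condition determines the form completely; invariance of `extForm` moves it to the preferred
chart of `T*M`. Uniqueness of the metric and the smoothness of the constructed form both rest on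
this. -/
lemma IsExtensionForm.components {val : Π θ : Cotangent E M,
    TangentSpace (cotangentModel E) θ →L[ℝ] TangentSpace (cotangentModel E) θ →L[ℝ] ℝ}
    (hval : IsExtensionForm D val) (θ₀ θ : Cotangent E M)
    (hθ : θ ∈ (extChartAt (cotangentModel E) θ₀).source)
    (v w : TangentSpace (cotangentModel E) θ) :
    val θ v w = extForm (extChartAt (cotangentModel E) θ₀ θ).2
      (christoffelAt D θ₀.proj (extChartAt (cotangentModel E) θ₀ θ).1)
      (dchart (cotangentModel E) (extChartAt (cotangentModel E) θ₀) θ v)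
      (dchart (cotangentModel E) (extChartAt (cotangentModel E) θ₀) θ w) := by
  let c := chartAt E θ₀.proj
  have hc := IsManifold.chart_mem_maximalAtlas (I := 𝓘(ℝ, E)) (n := ∞) θ₀.proj
  have hc' := isSmoothChart_of_mem_maximalAtlas hc
  rw [mem_extChartAt_source_cotangent] at hθ
  obtain ⟨u, hu, ξ, rfl⟩ := exists_inducedChartSymm_eq hc' θ hθ
  obtain ⟨⟨a, α⟩, rfl⟩ := inducedCoordVector_surjective hc' (z := (u, ξ)) hu v
  obtain ⟨⟨b, β⟩, rfl⟩ := inducedCoordVector_surjective hc' (z := (u, ξ)) hu w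
  obtain ⟨Γ, hΓ⟩ := hc'.exists_hasChristoffel D
  have hz : u ∈ overlap (chartAt E θ₀.proj).toPartialEquiv (extChartAt 𝓘(ℝ, E) θ₀.proj) :=
    ⟨hu, by rw [extChartAt_source]; exact hθ⟩
  have h := extForm_cotangentTransition hc' (isSmoothChart_extChartAt θ₀.proj) hΓ
    (hasChristoffel_christoffelAt D θ₀.proj) (z := (u, ξ)) hz (a, α) (b, β)
  rw [hval _ hc u hu, christoffel_eq hc' hΓ hu,
    dchart_inducedCoordVector hc' θ₀.proj θ₀ rfl (z := (u, ξ)) hz,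
    dchart_inducedCoordVector hc' θ₀.proj θ₀ rfl (z := (u, ξ)) hz,
    extChartAt_inducedChartSymm hc' θ₀.proj θ₀ rfl (z := (u, ξ)) hz]
  refine Eq.trans ?_ h.symm
  rw [extForm_apply]

lemma IsRiemannianExtension.hasComponents
    {g : PseudoRiemannianMetric (cotangentModel E) (Cotangent E M)}
    (hg : IsRiemannianExtension D g) (θ : Cotangent E M) :
    g.HasComponents (extChartAt (cotangentModel E) θ)
      (fun z => extForm z.2 (christoffelAt D θ.proj z.1)) :=
  fun θ' hθ' v w => IsExtensionForm.components (val := g.val) hg θ θ' hθ' v w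

lemma IsRiemannianExtension.unique
    {g g' : PseudoRiemannianMetric (cotangentModel E) (Cotangent E M)}
    (hg : IsRiemannianExtension D g) (hg' : IsRiemannianExtension D g') : g' = g := by
  have h : g'.val = g.val := by
    ext θ v w
    rw [hg.hasComponents θ θ (mem_extChartAt_source θ),
      hg'.hasComponents θ θ (mem_extChartAt_source θ)]
  cases g
  cases g'
  cases h
  rfl

lemma christoffelAt_symm (hT : D.torsion = 0) (p : M) {u : E}
    (hu : u ∈ (extChartAt 𝓘(ℝ, E) p).target) (a b : E) :
    christoffelAt D p u a b = christoffelAt D p u b a :=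
  (hasChristoffel_christoffelAt D p).symm (isSmoothChart_extChartAt p) hT hu a b

lemma contDiffOn_christoffelAt [T2Space M] (hD : D.ContMDiffCovariantDerivative ∞) (p : M) :
    ContDiffOn ℝ ∞ (christoffelAt D p) (extChartAt 𝓘(ℝ, E) p).target :=
  (hasChristoffel_christoffelAt D p).contDiffOn (isSmoothChart_extChartAt p) hD

/-- The Riemannian extension of a smooth torsion-free connection. -/
def riemannianExtension [T2Space M] (hD : D.ContMDiffCovariantDerivative ∞)
    (hT : D.torsion = 0) : PseudoRiemannianMetric (cotangentModel E) (Cotangent E M) where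
  val := riemannianExtensionForm D
  symm θ v w := by
    rw [riemannianExtensionForm_apply, riemannianExtensionForm_apply]
    exact extForm_symm _ (christoffelAt_symm hT θ.proj (mem_extChartAt_target _)) _ _
  nondegenerate θ v hv := by
    have hΦ := isSmoothChart_extChartAt (J := cotangentModel E) θ
    have hθ := mem_extChartAt_source (I := cotangentModel E) θ
    refine hΦ.dchart_injective hθ (Eq.trans ?_ (ContinuousLinearMap.map_zero _).symm)
    refine extForm_nondegenerate (extChartAt (cotangentModel E) θ θ).2
      (christoffelAt D θ.proj (extChartAt 𝓘(ℝ, E) θ.proj θ.proj)) _ fun b => ?_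
    obtain ⟨w, rfl⟩ := hΦ.dchart_surjective hθ b
    rw [← riemannianExtensionForm_apply, hv w]
  contMDiff := by
    refine contMDiff_of_components _
      (fun θ z => extForm z.2 (christoffelAt D θ.proj z.1)) (fun θ => ?_) fun θ θ' hθ' v w =>
        (isExtensionForm_riemannianExtensionForm D).components θ θ' hθ' v w
    rw [extChartAt_target_cotangent]
    exact contDiffOn_extForm (contDiffOn_christoffelAt hD θ.proj)

lemma isRiemannianExtension_riemannianExtension [T2Space M]
    (hD : D.ContMDiffCovariantDerivative ∞) (hT : D.torsion = 0) :
    IsRiemannianExtension D (riemannianExtension hD hT) :=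
  isExtensionForm_riemannianExtensionForm D

lemma IsRiemannianExtension.hasSignature (hT : D.torsion = 0)
    {g : PseudoRiemannianMetric (cotangentModel E) (Cotangent E M)}
    (hg : IsRiemannianExtension D g) :
    g.HasSignature (Module.finrank ℝ E) (Module.finrank ℝ E) := by
  intro θ
  have hΦ := isSmoothChart_extChartAt (J := cotangentModel E) θ
  have hθ := mem_extChartAt_source (I := cotangentModel E) θ
  have hz := mem_extChartAt_target (I := cotangentModel E) θ
  rw [mem_extChartAt_target_cotangent] at hz
  obtain ⟨b, h1, h2, h3⟩ := exists_orthonormal_basis_extForm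
    (extChartAt (cotangentModel E) θ θ).2 (christoffelAt_symm hT θ.proj hz)
  let e : (E × (E →L[ℝ] ℝ)) ≃ₗ[ℝ] TangentSpace (cotangentModel E) θ :=
    (hΦ.derivEquiv hθ).symm.toLinearEquiv
  have key (i j) : g.val θ (b.map e i) (b.map e j) = extForm (extChartAt (cotangentModel E) θ θ).2
      (christoffelAt D θ.proj (extChartAt (cotangentModel E) θ θ).1) (b i) (b j) := by
    have he (a) : dchart (cotangentModel E) (extChartAt (cotangentModel E) θ) θ (e a) = a :=
      (hΦ.derivEquiv hθ).apply_symm_apply a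
    rw [hg.hasComponents θ θ hθ, Module.Basis.map_apply, Module.Basis.map_apply, he, he]
  refine ⟨b.map e, fun i j hij => ?_, fun i => ?_, fun i => ?_⟩
  · rw [key, h1 i j hij]
  · rw [key, h2]
  · rw [key, h3]

end RiemannianExtension

/-! ### Comparison of the two Szabó conditions. -/

section Szabo

open Polynomial

variable {E : Type*} [NormedAddCommGroup E] [NormedSpace ℝ E] [FiniteDimensional ℝ E]
  [CompleteSpace E] {M : Type*} [TopologicalSpace M] [T2Space M] [ChartedSpace E M]
  [IsManifold 𝓘(ℝ, E) ∞ M]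
  {D : CovariantDerivative 𝓘(ℝ, E) E (TangentSpace 𝓘(ℝ, E) : M → Type _)}

lemma szaboOperator_smul (hD : D.ContMDiffCovariantDerivative ∞) (p : M) (r : ℝ)
    (v : TangentSpace 𝓘(ℝ, E) p) : szaboOperator D p (r • v) = r ^ 3 • szaboOperator D p v := by
  have hφ := isSmoothChart_extChartAt (J := 𝓘(ℝ, E)) p
  have hΓ := contDiffOn_christoffelAt hD p
  have h := dchart_szaboOperator p (hasChristoffel_christoffelAt D p) hΓ
  ext w
  refine hφ.dchart_injective (mem_extChartAt_source p) ?_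
  rw [h, ContinuousLinearMap.map_smul,
    localSzabo_smul_left hφ.isOpen_target hΓ (mem_extChartAt_target p), ← h,
    ← ContinuousLinearMap.map_smul]
  rfl

/-- Doubling `v` multiplies the operator by `2 ^ 3 > 1`, so the scaling argument applies. The single
comparison of `v` with `2v` is all that is used. -/
lemma charpoly_szaboOperator_eq_X_pow (hD : D.ContMDiffCovariantDerivative ∞) (p : M)
    (v : TangentSpace 𝓘(ℝ, E) p)
    (h : (szaboOperator D p ((2 : ℝ) • v)).charpoly = (szaboOperator D p v).charpoly) :
    (szaboOperator D p v).charpoly = X ^ Module.finrank ℝ E := by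
  rw [szaboOperator_smul hD] at h
  exact charpoly_eq_X_pow_of_smul (E := E) (szaboOperator D p v) (by norm_num) h

lemma fderiv_christoffelAt_symm (hD : D.ContMDiffCovariantDerivative ∞) (hT : D.torsion = 0)
    (p : M) {u : E} (hu : u ∈ (extChartAt 𝓘(ℝ, E) p).target) (c a b : E) :
    fderiv ℝ (christoffelAt D p) u c a b = fderiv ℝ (christoffelAt D p) u c b a := by
  have hU := isOpen_extChartAt_target (I := 𝓘(ℝ, E)) p
  have hd := (contDiffOn_christoffelAt hD p).differentiableAt_of_isOpen hU hu
  rw [fderiv_clm_apply_apply hd, fderiv_clm_apply_apply hd]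
  have e : (fun y => christoffelAt D p y a b) =ᶠ[nhds u] fun y => christoffelAt D p y b a := by
    filter_upwards [hU.mem_nhds hu] with y hy using christoffelAt_symm hT p hy a b
  rw [e.fderiv_eq]

variable {g : PseudoRiemannianMetric (cotangentModel E) (Cotangent E M)}

lemma differentiableAt_extForm (hD : D.ContMDiffCovariantDerivative ∞)
    (p : M) {z : E × (E →L[ℝ] ℝ)} (hz : z.1 ∈ (extChartAt 𝓘(ℝ, E) p).target) :
    DifferentiableAt ℝ (fun z : E × (E →L[ℝ] ℝ) => extForm z.2 (christoffelAt D p z.1)) z :=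
  (contDiffOn_extForm (contDiffOn_christoffelAt hD p)).differentiableAt_of_isOpen
    ((isOpen_extChartAt_target p).prod isOpen_univ) ⟨hz, trivial⟩

lemma fderiv_extForm_christoffelAt (hD : D.ContMDiffCovariantDerivative ∞) (hT : D.torsion = 0)
    (p : M) {z : E × (E →L[ℝ] ℝ)} (hz : z.1 ∈ (extChartAt 𝓘(ℝ, E) p).target)
    (C A B : E × (E →L[ℝ] ℝ)) :
    fderiv ℝ (fun z : E × (E →L[ℝ] ℝ) => extForm z.2 (christoffelAt D p z.1)) z C A B =
      extForm z.2 (christoffelAt D p z.1) (extChristoffel (christoffelAt D p) z C A) B +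
        extForm z.2 (christoffelAt D p z.1) A (extChristoffel (christoffelAt D p) z C B) := by
  rw [fderiv_clm_apply_apply (differentiableAt_extForm hD p hz) C A B]
  exact fderiv_extForm_eq ((contDiffOn_christoffelAt hD p).differentiableAt_of_isOpen
    (isOpen_extChartAt_target p) hz) z.2 (christoffelAt_symm hT p hz)
    (fderiv_christoffelAt_symm hD hT p hz) C A B

lemma IsRiemannianExtension.exists_isLeviCivita (hD : D.ContMDiffCovariantDerivative ∞)
    (hT : D.torsion = 0) (hg : IsRiemannianExtension D g) :
    ∃ D' : CovariantDerivative (cotangentModel E) (E × (E →L[ℝ] ℝ))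
      (TangentSpace (cotangentModel E) : Cotangent E M → Type _), g.IsLeviCivita D' := by
  have hz (θ : Cotangent E M) : (extChartAt (cotangentModel E) θ θ).1 ∈
      (extChartAt 𝓘(ℝ, E) θ.proj).target :=
    (mem_extChartAt_target_cotangent θ _).1 (mem_extChartAt_target θ)
  let Γ (θ : Cotangent E M) :
      (E × (E →L[ℝ] ℝ)) →L[ℝ] (E × (E →L[ℝ] ℝ)) →L[ℝ] E × (E →L[ℝ] ℝ) :=
    extChristoffel (christoffelAt D θ.proj) (extChartAt (cotangentModel E) θ θ)
  let G (θ : Cotangent E M) (z : E × (E →L[ℝ] ℝ)) :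
      (E × (E →L[ℝ] ℝ)) →L[ℝ] (E × (E →L[ℝ] ℝ)) →L[ℝ] ℝ :=
    extForm z.2 (christoffelAt D θ.proj z.1)
  have hG (θ : Cotangent E M) : g.HasComponents (extChartAt (cotangentModel E) θ) (G θ) :=
    hg.hasComponents θ
  have hd (θ : Cotangent E M) :
      DifferentiableAt ℝ (G θ) (extChartAt (cotangentModel E) θ θ) :=
    differentiableAt_extForm hD θ.proj (hz θ)
  have hs (θ : Cotangent E M) (A B : E × (E →L[ℝ] ℝ)) : Γ θ A B = Γ θ B A :=
    extChristoffel_symm (christoffelAt_symm hT θ.proj (hz θ))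
      (fderiv_christoffelAt_symm hD hT θ.proj (hz θ)) A B
  have hm (θ : Cotangent E M) (C A B : E × (E →L[ℝ] ℝ)) :
      fderiv ℝ (G θ) (extChartAt (cotangentModel E) θ θ) C A B =
        G θ (extChartAt (cotangentModel E) θ θ) (Γ θ C A) B +
          G θ (extChartAt (cotangentModel E) θ θ) A (Γ θ C B) :=
    fderiv_extForm_christoffelAt hD hT θ.proj (hz θ) C A B
  exact ⟨connectionOfChristoffel Γ, isLeviCivita_connectionOfChristoffel Γ G hG hd hs hm⟩

variable {D' : CovariantDerivative (cotangentModel E) (E × (E →L[ℝ] ℝ))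
  (TangentSpace (cotangentModel E) : Cotangent E M → Type _)}

lemma IsRiemannianExtension.hasChristoffel (hD : D.ContMDiffCovariantDerivative ∞)
    (hT : D.torsion = 0) (hg : IsRiemannianExtension D g) (hD' : g.IsLeviCivita D')
    (θ : Cotangent E M) : HasChristoffel D' (extChartAt (cotangentModel E) θ)
      (extChristoffel (christoffelAt D θ.proj)) := by
  have hz (z) (h : z ∈ (extChartAt (cotangentModel E) θ).target) :=
    (mem_extChartAt_target_cotangent θ z).1 h
  exact hD'.hasChristoffel (isSmoothChart_extChartAt θ) (hg.hasComponents θ)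
    (fun z h => differentiableAt_extForm hD θ.proj (hz z h))
    (fun z h => extChristoffel_symm (christoffelAt_symm hT θ.proj (hz z h))
      (fderiv_christoffelAt_symm hD hT θ.proj (hz z h)))
    (fun z h => fderiv_extForm_christoffelAt hD hT θ.proj (hz z h))

omit [FiniteDimensional ℝ E] [CompleteSpace E] [T2Space M] in
lemma extChartAt_cotangent_self_fst (θ : Cotangent E M) :
    (extChartAt (cotangentModel E) θ θ).1 = extChartAt 𝓘(ℝ, E) θ.proj θ.proj := by
  rw [extChartAt_cotangent_apply θ θ (mem_chart_source E θ.proj)]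

/-- Only the base component of `V` enters: its covector component and the foot `θ` affect just the
off-diagonal block. -/
lemma IsRiemannianExtension.charpoly_szaboOperator (hD : D.ContMDiffCovariantDerivative ∞)
    (hT : D.torsion = 0) (hg : IsRiemannianExtension D g) (hD' : g.IsLeviCivita D')
    (θ : Cotangent E M) (V : TangentSpace (cotangentModel E) θ) (v : TangentSpace 𝓘(ℝ, E) θ.proj)
    (hV : (dchart (cotangentModel E) (extChartAt (cotangentModel E) θ) θ V).1 =
      dchart 𝓘(ℝ, E) (extChartAt 𝓘(ℝ, E) θ.proj) θ.proj v) :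
    (szaboOperator D' θ V).charpoly = (szaboOperator D θ.proj v).charpoly ^ 2 := by
  have hU := isOpen_extChartAt_target (I := 𝓘(ℝ, E)) θ.proj
  have hΓ := contDiffOn_christoffelAt hD θ.proj
  have hΓ' : ContDiffOn ℝ ∞ (extChristoffel (christoffelAt D θ.proj))
      (extChartAt (cotangentModel E) θ).target := by
    rw [extChartAt_target_cotangent]
    exact contDiffOn_extChristoffel hU hΓ
  have hz : (extChartAt (cotangentModel E) θ θ).1 ∈ (extChartAt 𝓘(ℝ, E) θ.proj).target :=
    (mem_extChartAt_target_cotangent θ _).1 (mem_extChartAt_target θ)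
  have e := extChartAt_cotangent_self_fst θ
  rw [SzaboGeometry.charpoly_szaboOperator θ (hg.hasChristoffel hD hT hD' θ) hΓ',
    SzaboGeometry.charpoly_szaboOperator θ.proj (hasChristoffel_christoffelAt D θ.proj) hΓ]
  refine charpoly_prod_dual _ _ (fun W => ?_) fun β c => ?_
  · rw [localSzaboLin_apply, localSzaboLin_apply, ← hV, ← e]
    exact localSzabo_extChristoffel_fst hU hΓ hz _ _
  · rw [localSzaboLin_apply, localSzaboLin_apply, ← hV, ← e]
    exact localSzabo_extChristoffel_vert hU hΓ
      (fun u hu a b => christoffelAt_symm hT θ.proj hu a b) hz _ _ _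

lemma IsRiemannianExtension.isAffineSzabo_iff (hD : D.ContMDiffCovariantDerivative ∞)
    (hT : D.torsion = 0) (hg : IsRiemannianExtension D g) : IsAffineSzabo D ↔ g.IsSzabo := by
  constructor
  · intro h
    obtain ⟨D', hD'⟩ := hg.exists_isLeviCivita hD hT
    -- All Szabó operators of the extension turn out nilpotent, so constancy holds on every tangent
    -- vector and not merely on the pseudo-spheres.
    have key (θ : Cotangent E M) (V : TangentSpace (cotangentModel E) θ) :
        (szaboOperator D' θ V).charpoly = (X ^ Module.finrank ℝ E) ^ 2 := by
      obtain ⟨v, hv⟩ := (isSmoothChart_extChartAt (J := 𝓘(ℝ, E)) θ.proj).dchart_surjective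
        (mem_extChartAt_source θ.proj)
        (dchart (cotangentModel E) (extChartAt (cotangentModel E) θ) θ V).1
      rw [hg.charpoly_szaboOperator hD hT hD' θ V v hv.symm,
        charpoly_szaboOperator_eq_X_pow hD θ.proj v (h _ _ _)]
    exact ⟨D', hD', fun ε _ x y v w _ _ => (key x v).trans (key y w).symm⟩
  · rintro ⟨D', hD', h⟩
    suffices key : ∀ (p : M) (v : TangentSpace 𝓘(ℝ, E) p),
        (szaboOperator D p v).charpoly = X ^ Module.finrank ℝ E from
      fun p v w => (key p v).trans (key p w).symm
    intro p v
    refine charpoly_szaboOperator_eq_X_pow hD p v ?_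
    by_cases hv : v = 0
    · rw [hv, smul_zero]
    -- At the zero covector the Christoffel term of the metric disappears and `g(V, V) = 2 α(a)`.
    let θ : Cotangent E M := ⟨p, 0⟩
    have hφ := isSmoothChart_extChartAt (J := 𝓘(ℝ, E)) p
    have hΦ := isSmoothChart_extChartAt (J := cotangentModel E) θ
    have hθ := mem_extChartAt_source (I := cotangentModel E) θ
    have hξ : (extChartAt (cotangentModel E) θ θ).2 = 0 := by
      rw [extChartAt_cotangent_apply θ θ (mem_chart_source E p)]
      exact ContinuousLinearMap.zero_comp _
    have hg' (V : TangentSpace (cotangentModel E) θ) (a : E) (α : E →L[ℝ] ℝ)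
        (hV : dchart (cotangentModel E) (extChartAt (cotangentModel E) θ) θ V = (a, α)) :
        g.val θ V V = α a + α a := by
      rw [hg.hasComponents θ θ hθ]
      beta_reduce
      rw [hξ, hV, extForm_apply]
      simp
    let a : E := dchart 𝓘(ℝ, E) (extChartAt 𝓘(ℝ, E) p) p v
    have ha : a ≠ 0 := fun h => hv (hφ.dchart_injective (mem_extChartAt_source p)
      (h.trans (ContinuousLinearMap.map_zero _).symm))
    -- The value `1/2` normalizes `(a, α)` to `g(V, V) = 1`. Rescaling to `(2a, α/2)` preserves this
    -- while doubling the base component, so only the case `ε = 1` of the hypothesis is needed.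
    obtain ⟨α, hα⟩ : ∃ α : E →L[ℝ] ℝ, α a = 1 / 2 := by
      obtain ⟨f, -, hf⟩ := exists_dual_vector ℝ a (norm_ne_zero_iff.2 ha)
      refine ⟨(1 / (2 * ‖a‖)) • f, ?_⟩
      have : ‖a‖ ≠ 0 := norm_ne_zero_iff.2 ha
      rw [clm_smul_apply, hf]
      simp only [RCLike.ofReal_real_eq_id, id_eq, smul_eq_mul]
      field_simp
    obtain ⟨V, hV⟩ := hΦ.dchart_surjective hθ (a, α)
    obtain ⟨W, hW⟩ := hΦ.dchart_surjective hθ ((2 : ℝ) • a, (1 / 2 : ℝ) • α)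
    have hVV : g.val θ V V = 1 := by
      rw [hg' V _ _ hV, hα]; norm_num
    have hWW : g.val θ W W = 1 := by
      rw [hg' W _ _ hW, clm_smul_apply, ContinuousLinearMap.map_smul, hα]
      norm_num
    have h1 := h 1 (Or.inl rfl) θ θ W V hWW hVV
    rw [hg.charpoly_szaboOperator hD hT hD' θ V v (by rw [hV]),
      hg.charpoly_szaboOperator hD hT hD' θ W ((2 : ℝ) • v)
        (by rw [hW, ContinuousLinearMap.map_smul])] at h1
    exact (LinearMap.charpoly_monic _).eq_of_sq_eq_sq (LinearMap.charpoly_monic _) h1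

end Szabo

end SzaboGeometry

end

theorem mainTheorem3 {E : Type*} [NormedAddCommGroup E] [NormedSpace ℝ E] [FiniteDimensional ℝ E]
    [CompleteSpace E] {M : Type*} [TopologicalSpace M] [T2Space M] [ChartedSpace E M]
    [IsManifold 𝓘(ℝ, E) ∞ M]
    (D : CovariantDerivative 𝓘(ℝ, E) E (TangentSpace 𝓘(ℝ, E) : M → Type _))
    (hD : D.ContMDiffCovariantDerivative ∞) (hT : D.torsion = 0) :
    ∃ g : SzaboGeometry.PseudoRiemannianMetric (𝓘(ℝ, E).prod 𝓘(ℝ, E →L[ℝ] ℝ))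
        (SzaboGeometry.Cotangent E M),
      SzaboGeometry.IsRiemannianExtension D g ∧
      (∀ g', SzaboGeometry.IsRiemannianExtension D g' → g' = g) ∧
      g.HasSignature (Module.finrank ℝ E) (Module.finrank ℝ E) ∧
      (SzaboGeometry.IsAffineSzabo D ↔ g.IsSzabo) := by
  have hg := SzaboGeometry.isRiemannianExtension_riemannianExtension hD hT
  exact ⟨_, hg, fun g' hg' => hg.unique hg', hg.hasSignature hT, hg.isAffineSzabo_iff hD hT⟩
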